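/- Let $m,n$ be non-negative integers and let $B(x,r)$ denote the closed Euclidean ball with centre $x$ and radius $r$. Let $\Lambda$ be a compact metric space and $\omega$ a finite non-zero Borel measure on $\Lambda$. For $\lambda\in\Lambda$ let $P_\lambda:\mathbb{R}^n\to\mathbb{R}^m$ be an orthogonal projection (that is, the orthogonal projection of $\mathbb{R}^n$ onto an $m$-dimensional linear subspace, followed by a linear isometry of this subspace onto $\mathbb{R}^m$), and suppose that $\lambda\mapsto P_\lambda x$ is continuous for every $x\in\mathbb{R}^n$. Write $P_{\lambda\sharp}\mu$ for the push-forward of $\mu$ under $P_\lambda$, $\mathcal L^m$ for Lebesgue measure on $\mathbb R^m$, $\mathcal H^s$ for $s$-dimensional Hausdorff (outer) measure (normalized as $\sum_i \operatorname{diam}(E_i)^s$ over coverings, without further constant), and $\dim$ for Hausdorff dimension. For a finite Borel measure $\nu$ on $\mathbb{R}^m$ let $$D(\nu,u)=\lim_{\delta\to0}\frac{\nu(B(u,\delta))}{\mathcal L^m(B(0,1))\,\delta^{m}},$$ which exists for $\mathcal L^m$-almost all $u\in\mathbb{R}^m$. Let $s>m$ be a real number. Let $\mathcal F_s$ be the set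 of all non-zero finite Borel measures $\mu$ on $\mathbb{R}^n$ with compact support contained in the unit ball $B(0,1)$ and with $\mu(B(x,r))\le r^s$ for all $x\in\mathbb{R}^n$, $r>0$. Suppose that for every $\mu\in\mathcal F_s$ we have $P_{\lambda\sharp}\mu\ll\mathcal L^m$ for $\omega$-almost all $\lambda\in\Lambda$, and that there is a positive number $C$ such that $$\iint D(P_{\lambda\sharp}\mu,u)^2\,d\mathcal L^m u\,d\omega\lambda<C\qquad\text{for all }\mu\in\mathcal F_s .$$ Then for every $\mathcal H^s$-measurable set $A\subset\mathbb{R}^n$ with $0<\mathcal H^s(A)<\infty$ and $$\liminf_{r\to0}(2r)^{-s}\mathcal H^s(A\cap B(x,r))>0\quad\text{for }\mathcal H^s\text{-almost all }x\in A,$$ the following hold: 1. $\dim\big(P_\lambda^{-1}\{P_\lambda x\}\cap A\big)=s-m$ for $\mathcal H^s\times\omega$-almost all $(x,\lambda)\in A\times\Lambda$; 2. for $\omega$-almost all $\lambda\in\Lambda$, $\ \mathcal L^m\big(\{u\in\mathbb{R}^m:\dim\big(P_\lambda^{-1}\{u\}\cap A\big)=s-m\}\big)>0$, where $\mathcal L^m$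 of a set is its outer measure. -/

import Mathlib

open MeasureTheory Filter Topology
open scoped ENNReal

/-- `P : ℝⁿ → ℝᵐ` is an orthogonal projection: it is the orthogonal projection of `ℝⁿ` onto an
(`m`-dimensional) linear subspace `V`, followed by a linear isometric identification
`V ≃ ℝᵐ`. -/
def IsOrthogonalProj {n m : ℕ}
    (P : EuclideanSpace ℝ (Fin n) →L[ℝ] EuclideanSpace ℝ (Fin m)) : Prop :=
  ∃ (V : Submodule ℝ (EuclideanSpace ℝ (Fin n))) (e : V ≃ₗᵢ[ℝ] EuclideanSpace ℝ (Fin m)),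
    ∀ x, P x = e (V.orthogonalProjectionOnto x)

/-- The class `𝓜(A)` of non-zero finite Borel measures on `ℝⁿ` with compact support
contained in `A`. -/
def compactlySupportedMeasures {n : ℕ} (A : Set (EuclideanSpace ℝ (Fin n))) :
    Set (Measure (EuclideanSpace ℝ (Fin n))) :=
  {μ | μ ≠ 0 ∧ μ Set.univ < ∞ ∧ IsCompact μ.support ∧ μ.support ⊆ A}

/-- The Frostman condition `μ(B(x,r)) ≤ rˢ` for all closed balls of positive radius. -/
def FrostmanBound {n : ℕ} (s : ℝ) (μ : Measure (EuclideanSpace ℝ (Fin n))) : Prop :=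
  ∀ (x : EuclideanSpace ℝ (Fin n)) (r : ℝ), 0 < r →
    μ (Metric.closedBall x r) ≤ ENNReal.ofReal (r ^ s)

/-- The derivative `D(ν,u) = lim_{δ → 0+} α(m)⁻¹ δ⁻ᵐ ν(B(u,δ))`, with `α(m)` the Lebesgue measure
of the closed unit ball of `ℝᵐ`. For a finite measure `ν` the limit exists for Lebesgue almost all
`u`; the value of `limUnder` at the other points is immaterial. -/
noncomputable def measureDeriv {m : ℕ} (ν : Measure (EuclideanSpace ℝ (Fin m)))
    (u : EuclideanSpace ℝ (Fin m)) : ℝ≥0∞ :=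
  limUnder (𝓝[>] (0 : ℝ)) fun δ : ℝ =>
    (volume (Metric.closedBall (0 : EuclideanSpace ℝ (Fin m)) 1))⁻¹ *
      (ENNReal.ofReal δ ^ m)⁻¹ * ν (Metric.closedBall u δ)

/-- The lower `s`-density `liminf_{r → 0+} (2r)⁻ˢ 𝓗ˢ(A ∩ B(x,r))`. -/
noncomputable def lowerDensity {n : ℕ} (s : ℝ) (A : Set (EuclideanSpace ℝ (Fin n)))
    (x : EuclideanSpace ℝ (Fin n)) : ℝ≥0∞ :=
  liminf (fun r : ℝ => ENNReal.ofReal ((2 * r) ^ (-s)) * μH[s] (A ∩ Metric.closedBall x r))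
    (𝓝[>] (0 : ℝ))

/-! The upper bound needs only `μH[s] A < ∞` and 1-Lipschitz maps. Cover `A` by sets `E` of small
diameter with `∑ diam(E)^s` bounded. A fibre over `u` is covered by the `E` whose image contains
`u`, and integrating `∑ diam(E)^(s-m)` over these `u` costs a further factor `diam(E)^m` per set. By
Fatou almost every fibre has finite `μH[s - m]` measure (`exists_measurableSet_dimH_fiber_le`).

For the lower bound, exhaust `A` by sets `K` on which `μH[s]` restricted to `A` is comparable to
`r^s` on dyadic balls: the lower density assumption gives one inequality, the Vitali covering
theorem the other. Let `ν` be the restriction to `K`, `κ (l, u)` its conditional measures on the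
fibres and `g (l, ·)` the density of its projection. The projection of `ν` restricted to a ball `B`
has density `κ (l, u) B * g (l, u)`. Blowing `B` up to the unit ball turns the `L²` hypothesis into
a bound of order `r^(2s-m)` for the squared norm of this density. Regularity covers `K` by about
`r^(-s)` balls of radius `r`, so the energy of `κ (l, u)` at scale `r`, weighted by `g²`, integrates
to at most a constant times `r^(s-m)`. Summing over dyadic `r` gives finite `t`-energy for every `t
< s - m` on almost every fibre, hence dimension at least `t` (`exists_measurableSet_le_dimH_fiber`).

Both bounds are stated through measurable sets of pairs `(l, u)`, so that Fubini applies without any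
measurability of `dimH`. -/

open Metric Set ProbabilityTheory

/-! ### Derivatives of measures and dyadic radii -/

/-- The density of an absolutely continuous finite measure is its derivative along balls. -/
theorem measureDeriv_withDensity {m : ℕ} {f : EuclideanSpace ℝ (Fin m) → ℝ≥0∞}
    (hf : Measurable f) [IsFiniteMeasure (volume.withDensity f)] :
    measureDeriv (volume.withDensity f) =ᵐ[volume] f := by
  filter_upwards [Besicovitch.ae_tendsto_rnDeriv (volume.withDensity f) volume,
    Measure.rnDeriv_withDensity volume hf] with u hu hfu
  rw [hfu] at hu
  refine Tendsto.limUnder_eq (hu.congr' ?_)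
  filter_upwards [self_mem_nhdsWithin] with δ hδ
  have hδ0 : (0 : ℝ) < δ := hδ
  rw [Measure.addHaar_closedBall' volume u hδ0.le, finrank_euclideanSpace, Fintype.card_fin,
    ENNReal.ofReal_pow hδ0.le, div_eq_mul_inv, ENNReal.mul_inv, mul_comm]
  · ring
  · exact Or.inl (pow_ne_zero _ (by simpa using hδ0))
  · exact Or.inl (ENNReal.pow_ne_top ENNReal.ofReal_ne_top)


/-- A power bound on dyadic radii passes to all small radii. -/
theorem measure_closedBall_le_of_dyadic {X : Type*} [PseudoMetricSpace X] [MeasurableSpace X]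
    {κ : Measure X} {x : X} {M : ℝ≥0∞} {t : ℝ} (ht : 0 ≤ t)
    {k₀ : ℕ} (h : ∀ k ≥ k₀, κ (closedBall x ((1 / 2) ^ k)) ≤ M * ENNReal.ofReal (((1 / 2) ^ k) ^ t))
    {r : ℝ} (hr : 0 < r) (hr1 : r ≤ (1 / 2) ^ k₀) :
    κ (closedBall x r) ≤ M * ENNReal.ofReal (2 ^ t) * ENNReal.ofReal (r ^ t) := by
  obtain ⟨k, hk1, hk2⟩ := exists_nat_pow_near_of_lt_one hr
    (hr1.trans (pow_le_one₀ (by norm_num) (by norm_num))) (by norm_num : (0 : ℝ) < 1 / 2)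
    (by norm_num)
  have hk : k₀ ≤ k := by
    have := (pow_lt_pow_iff_right_of_lt_one₀ (by norm_num : (0 : ℝ) < 1 / 2) (by norm_num)).1
      (hk1.trans_le hr1)
    omega
  calc κ (closedBall x r) ≤ κ (closedBall x ((1 / 2) ^ k)) :=
        measure_mono (closedBall_subset_closedBall hk2)
    _ ≤ M * ENNReal.ofReal (((1 / 2) ^ k) ^ t) := h k hk
    _ ≤ M * ENNReal.ofReal ((2 * r) ^ t) := by
        gcongr
        rw [pow_succ] at hk1; linarith
    _ = _ := by
        rw [Real.mul_rpow (by norm_num) hr.le, ENNReal.ofReal_mul (by positivity), mul_assoc]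

/-! ### Energies, Vitali coverings and upper densities -/

section Metric

variable {X : Type*} [MetricSpace X] [MeasurableSpace X] [BorelSpace X]

theorem measurableSet_dist_le [SecondCountableTopology X] (r : ℝ) :
    MeasurableSet {p : X × X | dist p.1 p.2 ≤ r} :=
  (isClosed_le continuous_dist continuous_const).measurableSet

theorem measurable_measure_closedBall [SecondCountableTopology X] (κ : Measure X) [SFinite κ]
    (r : ℝ) : Measurable fun x => κ (closedBall x r) := by
  have h := measurable_measure_prodMk_left (ν := κ) (measurableSet_dist_le (X := X) r)
  have h' : ∀ x : X, Prod.mk x ⁻¹' {p : X × X | dist p.1 p.2 ≤ r} = closedBall x r := by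
    intro x; ext y; simp [dist_comm]
  simpa only [h'] using h

/-- Mass distribution principle. -/
theorem le_dimH_of_measure_closedBall_le {κ : Measure X} {S T : Set X} (hT : MeasurableSet T)
    {M : ℝ≥0∞} (hM : M ≠ ∞) {t : ℝ} (ht : 0 < t)
    (h : ∀ y ∈ T, ∀ k : ℕ, κ (closedBall y ((1 / 2) ^ k)) ≤ M * ENNReal.ofReal (((1 / 2) ^ k) ^ t))
    (hST : κ (S ∩ T) ≠ 0) : ENNReal.ofReal t ≤ dimH S := by
  -- The summand 1 keeps `c` invertible when `M = 0`; the factor `2 ^ t` pays for passing from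
  -- dyadic to arbitrary radii.
  set c : ℝ≥0∞ := (M + 1) * ENNReal.ofReal (2 ^ t) with hc
  have hc0 : c ≠ 0 := mul_ne_zero (by simp) (by simp; positivity)
  have hct : c ≠ ∞ := ENNReal.mul_ne_top (by simp [hM]) ENNReal.ofReal_ne_top
  have hball : ∀ y ∈ T, ∀ r : ℝ, 0 < r → r ≤ 1 →
      κ (closedBall y r) ≤ c * ENNReal.ofReal (r ^ t) := by
    intro y hy r hr hr1
    refine (measure_closedBall_le_of_dyadic ht.le (k₀ := 0) (fun k _ => h y hy k) hr
      (by simpa using hr1)).trans ?_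
    rw [hc]; gcongr; exact le_self_add
  -- Sets of diameter zero are compared with balls of radius zero, which the power bound reaches
  -- only in the limit.
  have hball0 : ∀ y ∈ T, κ (closedBall y 0) = 0 := by
    intro y hy
    have hlim : Tendsto (fun r : ℝ => c * ENNReal.ofReal (r ^ t)) (𝓝[>] 0) (𝓝 0) := by
      have : Tendsto (fun r : ℝ => r ^ t) (𝓝[>] 0) (𝓝 0) := by
        have := (Real.continuousAt_rpow_const 0 t (Or.inr ht.le)).tendsto
        rw [Real.zero_rpow ht.ne'] at this
        exact this.mono_left nhdsWithin_le_nhds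
      have := ENNReal.Tendsto.const_mul (ENNReal.tendsto_ofReal this) (Or.inr hct)
      simpa using this
    refine le_antisymm (ge_of_tendsto hlim ?_) bot_le
    filter_upwards [Ioc_mem_nhdsGT (zero_lt_one (α := ℝ))] with r hr
    exact (measure_mono (closedBall_subset_closedBall hr.1.le)).trans (hball y hy r hr.1 hr.2)
  have hle : c⁻¹ • κ.restrict T ≤ μH[t] := by
    refine Measure.le_hausdorffMeasure t _ 1 one_pos fun E hE => ?_
    rw [Measure.smul_apply, smul_eq_mul, Measure.restrict_apply' hT]
    rcases (E ∩ T).eq_empty_or_nonempty with he | ⟨y, hyE, hyT⟩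
    · simp [he]
    have hfin : ediam E ≠ ∞ := ne_top_of_le_ne_top ENNReal.one_ne_top hE
    have hsub : E ∩ T ⊆ closedBall y (ediam E).toReal := fun z hz =>
      mem_closedBall.2 (by
        rw [dist_edist]
        exact ENNReal.toReal_mono hfin (edist_le_ediam_of_mem hz.1 hyE))
    refine (mul_le_mul_right (measure_mono hsub) _).trans ?_
    rcases eq_or_ne (ediam E) 0 with h0 | h0
    · rw [h0, ENNReal.toReal_zero, hball0 y hyT, mul_zero]
      exact bot_le
    have hpos : 0 < (ediam E).toReal := ENNReal.toReal_pos h0 hfin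
    refine (mul_le_mul_right (hball y hyT _ hpos
      (ENNReal.toReal_mono ENNReal.one_ne_top hE)) _).trans ?_
    rw [← mul_assoc, ENNReal.inv_mul_cancel hc0 hct, one_mul,
      ← ENNReal.ofReal_rpow_of_pos hpos, ENNReal.ofReal_toReal hfin]
  have hS : μH[t] S ≠ 0 := by
    intro h0
    have := hle S
    rw [h0, Measure.smul_apply, smul_eq_mul, Measure.restrict_apply' hT, nonpos_iff_eq_zero,
      mul_eq_zero] at this
    rcases this with h1 | h1
    · exact hct (by simpa using h1)
    · exact hST h1
  have : μH[((t.toNNReal : NNReal) : ℝ)] S ≠ 0 := by rwa [Real.coe_toNNReal t ht.le]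
  exact le_dimH_of_hausdorffMeasure_ne_zero this

/-- A set charged by a measure of finite dyadic `t`-energy has dimension at least `t`. -/
theorem le_dimH_of_tsum_lintegral_closedBall [SecondCountableTopology X] {κ : Measure X}
    [IsFiniteMeasure κ] {S : Set X} {t : ℝ} (ht : 0 < t)
    (h : ∑' k : ℕ, ENNReal.ofReal (((1 / 2) ^ k) ^ (-t)) *
      ∫⁻ y, κ (closedBall y ((1 / 2) ^ k)) ∂κ ≠ ∞) (hS : κ S ≠ 0) :
    ENNReal.ofReal t ≤ dimH S := by
  have hmeas : ∀ k : ℕ, Measurable fun y => ENNReal.ofReal (((1 / 2) ^ k) ^ (-t)) *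
      κ (closedBall y ((1 / 2) ^ k)) := fun k => (measurable_measure_closedBall κ _).const_mul _
  have hfin : ∀ᵐ y ∂κ, ∑' k : ℕ, ENNReal.ofReal (((1 / 2) ^ k) ^ (-t)) *
      κ (closedBall y ((1 / 2) ^ k)) < ∞ := by
    refine ae_lt_top (Measurable.tsum hmeas) ?_
    rw [lintegral_tsum fun k => (hmeas k).aemeasurable]
    simpa only [lintegral_const_mul _ (measurable_measure_closedBall κ _)] using h
  -- Sublevel sets of the dyadic potential: on each of them a single term of the series already
  -- gives the ball bound of the mass distribution principle.
  set T : ℕ → Set X := fun M => {y | ∑' k : ℕ, ENNReal.ofReal (((1 / 2) ^ k) ^ (-t)) *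
      κ (closedBall y ((1 / 2) ^ k)) ≤ M} with hT
  have hTm : ∀ M, MeasurableSet (T M) := fun M =>
    measurableSet_le (Measurable.tsum hmeas) measurable_const
  obtain ⟨M, hM⟩ : ∃ M, κ (S ∩ T M) ≠ 0 := by
    by_contra! hcon
    refine hS (measure_mono_null (t := (⋃ M, S ∩ T M) ∪ {y | ¬ ∑' k : ℕ,
      ENNReal.ofReal (((1 / 2) ^ k) ^ (-t)) * κ (closedBall y ((1 / 2) ^ k)) < ∞}) ?_ ?_)
    · intro y hy
      by_cases hy' : ∑' k : ℕ, ENNReal.ofReal (((1 / 2) ^ k) ^ (-t)) *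
        κ (closedBall y ((1 / 2) ^ k)) < ∞
      · obtain ⟨M, hM⟩ := ENNReal.exists_nat_gt hy'.ne
        exact Or.inl (mem_iUnion.2 ⟨M, hy, hM.le⟩)
      · exact Or.inr hy'
    · exact measure_union_null (measure_iUnion_null hcon) hfin
  refine le_dimH_of_measure_closedBall_le (hTm M) (ENNReal.natCast_ne_top M) ht ?_ hM
  intro y hy k
  have h1 := (ENNReal.le_tsum k).trans hy
  have hp : (0 : ℝ) < (1 / 2) ^ k := by positivity
  calc κ (closedBall y ((1 / 2) ^ k))
      = ENNReal.ofReal (((1 / 2) ^ k) ^ t) * (ENNReal.ofReal (((1 / 2) ^ k) ^ (-t)) *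
        κ (closedBall y ((1 / 2) ^ k))) := by
        rw [← mul_assoc, ← ENNReal.ofReal_mul (by positivity), ← Real.rpow_add hp]
        simp
    _ ≤ ENNReal.ofReal (((1 / 2) ^ k) ^ t) * M := by gcongr
    _ = _ := mul_comm _ _

/-- If balls of radius `r` centred on `K` have mass at least `c`, then `K` is covered by at most
`μ univ / c` balls of radius `5 r`. -/
theorem exists_cover_closedBall_of_le_measure {μ : Measure X} [IsFiniteMeasure μ] {K : Set X}
    {c : ℝ≥0∞} (hc : c ≠ 0) {r : ℝ} (hr : 0 ≤ r) (h : ∀ x ∈ K, c ≤ μ (closedBall x r)) :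
    ∃ u : Set X, u.Countable ∧ K ⊆ ⋃ x ∈ u, closedBall x (5 * r) ∧ ∑' _ : u, c ≤ μ univ := by
  obtain ⟨u, huK, hdisj, hcov⟩ := Vitali.exists_disjoint_subfamily_covering_enlargement_closedBall
    K (fun x => x) (fun _ => r) r (fun _ _ => le_rfl) 5 (by norm_num)
  have hcount : ∑' _ : u, c ≤ μ univ := by
    calc ∑' _ : u, c ≤ ∑' x : u, μ (closedBall (x : X) r) :=
          ENNReal.tsum_le_tsum fun x => h x (huK x.2)
      _ ≤ μ (⋃ x : u, closedBall (x : X) r) :=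
          tsum_meas_le_meas_iUnion_of_disjoint _ (fun _ => measurableSet_closedBall)
            (fun x y hxy => hdisj x.2 y.2 (fun h => hxy (Subtype.ext h)))
      _ ≤ μ univ := measure_mono (subset_univ _)
  refine ⟨u, ?_, ?_, hcount⟩
  · have := Summable.countable_support_ennreal (f := fun _ : u => c)
      (ne_top_of_le_ne_top (measure_ne_top μ univ) hcount)
    rw [Function.support_const hc] at this
    exact countable_coe_iff.1 (countable_univ_iff.1 this)
  · intro x hx
    obtain ⟨b, hb, hsub⟩ := hcov x hx
    exact mem_biUnion hb (hsub (mem_closedBall_self hr))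

/-- For a finite measure the dyadic upper `s`-density is finite `μH[s]`-almost everywhere. -/
theorem ae_exists_measure_closedBall_le [TopologicalSpace.SeparableSpace X] (μ : Measure X)
    [IsFiniteMeasure μ]
    {s : ℝ} (hs : 0 < s) :
    ∀ᵐ x ∂(μH[s] : Measure X), ∃ M : ℕ, ∀ᶠ k : ℕ in atTop,
      μ (closedBall x ((1 / 2) ^ k)) ≤ M * ENNReal.ofReal (((1 / 2) ^ k) ^ s) := by
  -- Points whose dyadic upper density is at least about `M`. Their measure is `O(1 / M)`, so the
  -- intersection over `M` is null.
  set B : ℕ → Set X := fun M => {x | ∃ᶠ k : ℕ in atTop,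
    M * ENNReal.ofReal (((1 / 2) ^ k) ^ s) < μ (closedBall x ((1 / 2) ^ k))} with hB
  have key : ∀ M : ℕ, M * μH[s] (B M) ≤ ENNReal.ofReal (10 ^ s) * μ univ := by
    intro M
    rcases Nat.eq_zero_or_pos M with rfl | hMpos
    · simp
    have hM0 : (M : ℝ≥0∞) ≠ 0 := by exact_mod_cast hMpos.ne'
    have hMt : (M : ℝ≥0∞) ≠ ∞ := ENNReal.natCast_ne_top M
    -- disjoint balls of radius at most `2⁻ⁱ`
    have hcov : ∀ i : ℕ, ∃ u : Set (X × ℕ), u.Countable ∧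
        (∀ p ∈ u, i ≤ p.2) ∧ B M ⊆ ⋃ p : u, closedBall (p : X × ℕ).1 (5 * (1 / 2) ^ (p : X × ℕ).2) ∧
        M * ∑' p : u, ENNReal.ofReal (((1 / 2) ^ (p : X × ℕ).2) ^ s) ≤ μ univ := by
      intro i
      set T : Set (X × ℕ) := {p | i ≤ p.2 ∧
        M * ENNReal.ofReal (((1 / 2) ^ p.2) ^ s) < μ (closedBall p.1 ((1 / 2) ^ p.2))} with hT
      obtain ⟨u, huT, hdisj, hcov⟩ :=
        Vitali.exists_disjoint_subfamily_covering_enlargement_closedBall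
          T (fun p => p.1) (fun p => (1 / 2) ^ p.2) 1
          (fun p _ => pow_le_one₀ (by norm_num) (by norm_num)) 5 (by norm_num)
      have hsum : M * ∑' p : u, ENNReal.ofReal (((1 / 2) ^ (p : X × ℕ).2) ^ s) ≤ μ univ := by
        rw [← ENNReal.tsum_mul_left]
        calc ∑' p : u, M * ENNReal.ofReal (((1 / 2) ^ (p : X × ℕ).2) ^ s)
            ≤ ∑' p : u, μ (closedBall (p : X × ℕ).1 ((1 / 2) ^ (p : X × ℕ).2)) :=
              ENNReal.tsum_le_tsum fun p => (huT p.2).2.le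
          _ ≤ μ (⋃ p : u, closedBall (p : X × ℕ).1 ((1 / 2) ^ (p : X × ℕ).2)) :=
              tsum_meas_le_meas_iUnion_of_disjoint _ (fun _ => measurableSet_closedBall)
                (fun x y hxy => hdisj x.2 y.2 (fun h => hxy (Subtype.ext h)))
          _ ≤ μ univ := measure_mono (subset_univ _)
      refine ⟨u, ?_, fun p hp => (huT hp).1, ?_, hsum⟩
      · refine hdisj.countable_of_nonempty_interior fun p _ => ?_
        exact ⟨p.1, ball_subset_interior_closedBall (mem_ball_self (by positivity))⟩
      · intro x hx
        obtain ⟨k, hki, hk⟩ := (frequently_atTop.1 hx) i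
        obtain ⟨b, hb, hsub⟩ := hcov (x, k) ⟨hki, hk⟩
        exact mem_iUnion.2 ⟨⟨b, hb⟩, hsub (mem_closedBall_self (by positivity))⟩
    choose u huc hui hucov husum using hcov
    have : ∀ i, Countable (u i) := fun i => countable_coe_iff.2 (huc i)
    -- The 10 is twice the Vitali enlargement factor 5.
    have hdiam : ∀ i (p : u i), ediam (closedBall (p : X × ℕ).1 (5 * (1 / 2) ^ (p : X × ℕ).2))
        ≤ ENNReal.ofReal (10 * (1 / 2) ^ (p : X × ℕ).2) := by
      intro i p
      rw [← closedEBall_ofReal (by positivity)]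
      refine ediam_closedEBall_le.trans ?_
      rw [← ENNReal.ofReal_ofNat, ← ENNReal.ofReal_mul (by norm_num)]
      exact ENNReal.ofReal_le_ofReal (by ring_nf; exact le_rfl)
    have hle := Measure.hausdorffMeasure_le_liminf_tsum (ι := fun i => u i) s (B M) (l := atTop)
      (fun i : ℕ => ENNReal.ofReal (10 * (1 / 2) ^ i))
      (by
        have h1 : Tendsto (fun i : ℕ => (10 : ℝ) * (1 / 2) ^ i) atTop (𝓝 (10 * 0)) :=
          (tendsto_pow_atTop_nhds_zero_of_lt_one (by norm_num) (by norm_num)).const_mul _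
        simpa using ENNReal.tendsto_ofReal h1)
      (fun i p => closedBall (p : X × ℕ).1 (5 * (1 / 2) ^ (p : X × ℕ).2))
      (Eventually.of_forall fun i p => (hdiam i p).trans (by
        gcongr ENNReal.ofReal (10 * ?_)
        exact pow_le_pow_of_le_one (by norm_num) (by norm_num) (hui i p p.2)))
      (Eventually.of_forall fun i => hucov i)
    have hbound : ∀ i, ∑' p : u i,
        ediam (closedBall (p : X × ℕ).1 (5 * (1 / 2) ^ (p : X × ℕ).2)) ^ s
        ≤ (M : ℝ≥0∞)⁻¹ * (ENNReal.ofReal (10 ^ s) * μ univ) := by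
      intro i
      calc ∑' p : u i, ediam (closedBall (p : X × ℕ).1 (5 * (1 / 2) ^ (p : X × ℕ).2)) ^ s
          ≤ ∑' p : u i, ENNReal.ofReal (10 ^ s) *
              ENNReal.ofReal (((1 / 2) ^ (p : X × ℕ).2) ^ s) := by
            refine ENNReal.tsum_le_tsum fun p => ?_
            rw [← ENNReal.ofReal_mul (by positivity), ← Real.mul_rpow (by norm_num) (by positivity),
              ← ENNReal.ofReal_rpow_of_pos (by positivity)]
            exact ENNReal.rpow_le_rpow (hdiam i p) hs.le
        _ = (M : ℝ≥0∞)⁻¹ * (ENNReal.ofReal (10 ^ s) *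
              (M * ∑' p : u i, ENNReal.ofReal (((1 / 2) ^ (p : X × ℕ).2) ^ s))) := by
            rw [ENNReal.tsum_mul_left, mul_left_comm _ (M : ℝ≥0∞), ← mul_assoc (M : ℝ≥0∞)⁻¹,
              ENNReal.inv_mul_cancel hM0 hMt, one_mul]
        _ ≤ _ := by gcongr; exact husum i
    have := hle.trans (liminf_le_of_le (by isBoundedDefault) fun b hb => by
      obtain ⟨i, hi⟩ := hb.exists
      exact hi.trans (hbound i))
    calc M * μH[s] (B M) ≤ M * ((M : ℝ≥0∞)⁻¹ * (ENNReal.ofReal (10 ^ s) * μ univ)) := by gcongr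
      _ = _ := by rw [← mul_assoc, ENNReal.mul_inv_cancel hM0 hMt, one_mul]
  have hnull : μH[s] (⋂ M, B M) = 0 := by
    by_contra h0
    have hlt : ENNReal.ofReal (10 ^ s) * μ univ < ∞ :=
      ENNReal.mul_lt_top ENNReal.ofReal_lt_top (measure_lt_top μ univ)
    obtain ⟨M, hM⟩ := ENNReal.exists_nat_mul_gt h0 hlt.ne
    refine absurd (hM.trans_le ?_) (lt_irrefl _)
    exact (mul_le_mul_right (measure_mono (iInter_subset B M)) _).trans (key M)
  refine measure_mono_null (fun x hx => ?_) hnull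
  simp only [mem_compl_iff, mem_ofPred_eq, not_exists, mem_iInter, hB] at hx ⊢
  intro M
  exact (not_eventually.1 (hx M)).mono fun k hk => not_le.1 hk

end Metric

/-! ### Upper bound for the dimension of fibres -/

/-- Covers that nearly realize the Hausdorff measure. -/
theorem exists_cover_tsum_ediam_le {X : Type*} [MetricSpace X] [MeasurableSpace X] [BorelSpace X]
    {s : ℝ} (hs : 0 < s) {A : Set X} (hA : μH[s] A ≠ ∞) {r : ℝ≥0∞} (hr : 0 < r) :
    ∃ t : ℕ → Set X, A ⊆ ⋃ i, t i ∧ (∀ i, ediam (t i) ≤ r) ∧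
      ∑' i, ediam (t i) ^ s ≤ μH[s] A + 1 := by
  have h : (⨅ (t : ℕ → Set X) (_ : A ⊆ ⋃ n, t n) (_ : ∀ n, ediam (t n) ≤ r),
      ∑' n, ⨆ _ : (t n).Nonempty, ediam (t n) ^ s) < μH[s] A + 1 := by
    refine lt_of_le_of_lt ?_ (ENNReal.lt_add_right hA one_ne_zero)
    conv_rhs => rw [Measure.hausdorffMeasure_apply]
    exact le_iSup₂_of_le r hr le_rfl
  simp only [iInf_lt_iff] at h
  obtain ⟨t, hcov, hd, hlt⟩ := h
  refine ⟨t, hcov, hd, le_trans (ENNReal.tsum_le_tsum fun i => ?_) hlt.le⟩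
  rcases (t i).eq_empty_or_nonempty with he | hne
  · simp [he, hs]
  · simp [hne]

/-- Generic upper bound for the dimension of fibres under a measurable family of
1-Lipschitz maps to `ℝᵐ`. -/
theorem exists_measurableSet_dimH_fiber_le {Λ X : Type*} [MeasurableSpace Λ] [MetricSpace X]
    [MeasurableSpace X] [BorelSpace X] {m : ℕ} {P : Λ → X → EuclideanSpace ℝ (Fin m)}
    (hP : ∀ x, Measurable fun l => P l x) (hlip : ∀ l x y, dist (P l x) (P l y) ≤ dist x y)
    {s : ℝ} (hs : (m : ℝ) < s) {A : Set X} (hA : μH[s] A ≠ ∞) :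
    ∃ N : Set (Λ × EuclideanSpace ℝ (Fin m)), MeasurableSet N ∧
      (∀ l, volume {u | (l, u) ∈ N} = 0) ∧
      ∀ l u, (l, u) ∉ N → dimH (P l ⁻¹' {u} ∩ A) ≤ ENNReal.ofReal (s - m) := by
  rcases A.eq_empty_or_nonempty with rfl | ⟨x₀, -⟩
  · exact ⟨∅, MeasurableSet.empty, by simp, by simp⟩
  have hs0 : 0 < s := (Nat.cast_nonneg m).trans_lt hs
  have hd0 : 0 < s - m := sub_pos.2 hs
  have hcov := fun k : ℕ => exists_cover_tsum_ediam_le hs0 hA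
    (r := ((k : ℝ≥0∞) + 1)⁻¹) (by simp)
  choose t hcov hdiam hsum using hcov
  have hfin : ∀ k i, ediam (t k i) ≠ ∞ := fun k i =>
    ne_top_of_le_ne_top (by simp) (hdiam k i)
  have he : ∀ k i, ∃ e : X, ∀ y ∈ t k i, dist y e ≤ (ediam (t k i)).toReal := by
    intro k i
    rcases (t k i).eq_empty_or_nonempty with h | ⟨e, he⟩
    · exact ⟨x₀, by simp [h]⟩
    · refine ⟨e, fun y hy => ?_⟩
      rw [dist_edist]
      exact ENNReal.toReal_mono (hfin k i) (edist_le_ediam_of_mem hy he)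
  choose e he using he
  -- A measurable substitute for the images `P l '' t k i`: the ball around the image of one point,
  -- with the diameter of the covering set as radius, contains the image since `P l` is 1-Lipschitz.
  set D : ℕ → ℕ → Set (Λ × EuclideanSpace ℝ (Fin m)) := fun k i =>
    {p | dist p.2 (P p.1 (e k i)) ≤ (ediam (t k i)).toReal} with hD
  have hDm : ∀ k i, MeasurableSet (D k i) := fun k i =>
    measurableSet_le (measurable_snd.dist ((hP _).comp measurable_fst)) measurable_const
  set f : ℕ → Λ × EuclideanSpace ℝ (Fin m) → ℝ≥0∞ := fun k p =>
    ∑' i, ediam (t k i) ^ (s - m) * (D k i).indicator 1 p with hf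
  have hgm : ∀ k i, Measurable fun p => ediam (t k i) ^ (s - m) * (D k i).indicator 1 p :=
    fun k i => (measurable_one.indicator (hDm k i)).const_mul _
  have hfm : ∀ k, Measurable (f k) := fun k => Measurable.tsum fun i => hgm k i
  set c : ℝ≥0∞ := volume (closedBall (0 : EuclideanSpace ℝ (Fin m)) 1) with hc
  have hint : ∀ k l, ∫⁻ u, f k (l, u) ≤ (μH[s] A + 1) * c := by
    intro k l
    simp only [hf]
    have hgl : ∀ i, AEMeasurable (fun u => ediam (t k i) ^ (s - m) * (D k i).indicator 1 (l, u)) :=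
      fun i => ((hgm k i).comp measurable_prodMk_left).aemeasurable
    rw [lintegral_tsum hgl]
    calc ∑' i, ∫⁻ u, ediam (t k i) ^ (s - m) * (D k i).indicator 1 (l, u)
        = ∑' i, ediam (t k i) ^ s * c := by
          congr 1; ext i
          rw [lintegral_const_mul' _ _ (ENNReal.rpow_ne_top_of_nonneg hd0.le (hfin k i))]
          have : ∀ u, (D k i).indicator (1 : Λ × EuclideanSpace ℝ (Fin m) → ℝ≥0∞) (l, u) =
              (closedBall (P l (e k i)) (ediam (t k i)).toReal).indicator 1 u := by
            intro u; simp [hD, indicator, mem_closedBall]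
          simp only [this]
          rw [lintegral_indicator_one measurableSet_closedBall,
            Measure.addHaar_closedBall' _ _ ENNReal.toReal_nonneg, finrank_euclideanSpace,
            Fintype.card_fin, ENNReal.ofReal_pow ENNReal.toReal_nonneg,
            ENNReal.ofReal_toReal (hfin k i), ← mul_assoc, ← ENNReal.rpow_natCast,
            ← ENNReal.rpow_add_of_nonneg _ _ hd0.le (Nat.cast_nonneg m), sub_add_cancel]
      _ ≤ _ := by
          rw [ENNReal.tsum_mul_right]
          gcongr
          exact hsum k
  set F : Λ × EuclideanSpace ℝ (Fin m) → ℝ≥0∞ := fun p => liminf (fun k => f k p) atTop with hF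
  have hFm : Measurable F := Measurable.liminf hfm
  -- `F` has finite integral in `u` for each `l` and dominates `μH[s - m]` of the fibre, so its
  -- infinity set can serve as `N`.
  refine ⟨{p | F p = ∞}, measurableSet_eq_fun hFm measurable_const, fun l => ?_, fun l u hlu => ?_⟩
  · have h1 : ∫⁻ u, F (l, u) ≠ ∞ := by
      refine ne_top_of_le_ne_top (b := (μH[s] A + 1) * c) ?_ ?_
      · exact ENNReal.mul_ne_top (by simp [hA]) (isCompact_closedBall _ _).measure_lt_top.ne
      · refine (lintegral_liminf_le fun k => (hfm k).comp measurable_prodMk_left).trans ?_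
        refine liminf_le_of_le (by isBoundedDefault) fun b hb => ?_
        obtain ⟨k, hk⟩ := hb.exists
        exact hk.trans (hint k l)
    have h2 := ae_lt_top (hFm.comp measurable_prodMk_left) h1
    refine measure_mono_null (fun u hu => ?_) h2
    simpa using hu
  · have hle := Measure.hausdorffMeasure_le_liminf_tsum (ι := fun _ => ℕ) (s - m)
      (P l ⁻¹' {u} ∩ A) (l := atTop) (fun k : ℕ => ((k : ℝ≥0∞) + 1)⁻¹)
      (by
        have := (tendsto_add_atTop_iff_nat 1).2 ENNReal.tendsto_inv_nat_nhds_zero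
        simpa using this)
      (fun k i => P l ⁻¹' {u} ∩ t k i)
      (Eventually.of_forall fun k i => (ediam_mono inter_subset_right).trans (hdiam k i))
      (Eventually.of_forall fun k x hx => by
        obtain ⟨i, hi⟩ := mem_iUnion.1 (hcov k hx.2)
        exact mem_iUnion.2 ⟨i, hx.1, hi⟩)
    have hle2 : μH[s - m] (P l ⁻¹' {u} ∩ A) ≤ F (l, u) := by
      refine hle.trans (liminf_le_liminf (Eventually.of_forall fun k => ?_))
      refine ENNReal.tsum_le_tsum fun i => ?_
      rcases (P l ⁻¹' {u} ∩ t k i).eq_empty_or_nonempty with h | ⟨y, hyu, hyt⟩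
      · simp [h, hd0]
      · have hmem : (l, u) ∈ D k i := by
          have hyu' : P l y = u := hyu
          rw [hD, mem_ofPred_eq, ← hyu']
          exact (hlip l y _).trans (he k i y hyt)
        rw [indicator_of_mem hmem, Pi.one_apply, mul_one]
        exact ENNReal.rpow_le_rpow (ediam_mono inter_subset_right) hd0.le
    have hne : μH[((s - m).toNNReal : ℝ)] (P l ⁻¹' {u} ∩ A) ≠ ∞ := by
      rw [Real.coe_toNNReal _ hd0.le]
      exact ne_top_of_le_ne_top hlu hle2
    exact dimH_le_of_hausdorffMeasure_ne_top hne

/-! ### Disintegration along the projections -/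

/-- Simultaneous disintegration of a measure along a measurable family of maps, together with a
jointly measurable version of the densities of the push-forwards. -/
theorem exists_kernel_disintegration {Λ X Y : Type*} [MeasurableSpace Λ] [MeasurableSpace X]
    [StandardBorelSpace X] [Nonempty X] [MeasurableSpace Y] [StandardBorelSpace Y]
    {P : Λ → X → Y} (hP : Measurable fun p : Λ × X => P p.1 p.2) (μ : Measure X)
    [IsFiniteMeasure μ] (V : Measure Y) [IsFiniteMeasure V] :
    ∃ (κ : Kernel (Λ × Y) X) (g : Λ × Y → ℝ≥0∞), IsMarkovKernel κ ∧ Measurable g ∧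
      (∀ l (S : Set (Y × X)), MeasurableSet S → μ {x | (P l x, x) ∈ S} =
        ∫⁻ u, κ (l, u) (Prod.mk u ⁻¹' S) ∂(μ.map (P l))) ∧
      ∀ l, μ.map (P l) ≪ V → μ.map (P l) = V.withDensity fun u => g (l, u) := by
  have hPl : ∀ l, Measurable (P l) := fun l => hP.comp measurable_prodMk_left
  have hQ : Measurable fun p : Λ × X => (P p.1 p.2, p.2) := hP.prodMk measurable_snd
  -- `η l` is the image of `μ` on the graph of `P l`. Conditioning this kernel on its first
  -- coordinate disintegrates for all `l` at once, measurably in `(l, u)`.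
  set η : Kernel Λ (Y × X) := (Kernel.id ×ₖ Kernel.const Λ μ).map
    (fun p : Λ × X => (P p.1 p.2, p.2)) with hη
  have hηl : ∀ l, η l = μ.map fun x => (P l x, x) := by
    intro l
    rw [hη, Kernel.map_apply _ hQ, Kernel.prod_apply, Kernel.id_apply, Kernel.const_apply,
      Measure.dirac_prod, Measure.map_map hQ measurable_prodMk_left]
    rfl
  have hgr : ∀ l, Measurable fun x => (P l x, x) := fun l => (hPl l).prodMk measurable_id
  have hfst : ∀ l, η.fst l = μ.map (P l) := by
    intro l
    rw [Kernel.fst_apply, hηl, Measure.map_map measurable_fst (hgr l)]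
    rfl
  refine ⟨η.condKernel, fun p => η.fst.rnDeriv (Kernel.const Λ V) p.1 p.2, inferInstance,
    Kernel.measurable_rnDeriv _ _, fun l S hS => ?_, fun l hl => ?_⟩
  · have h := congrArg (fun ξ : Kernel Λ (Y × X) => ξ l S) (Kernel.disintegrate η η.condKernel)
    rw [Kernel.compProd_apply hS, hfst, hηl, Measure.map_apply (hgr l) hS] at h
    exact h.symm
  · have h := Kernel.withDensity_rnDeriv_eq (κ := η.fst) (η := Kernel.const Λ V) (a := l)
      (by rw [hfst, Kernel.const_apply]; exact hl)
    rw [Kernel.withDensity_apply _ (Kernel.measurable_rnDeriv _ _), hfst, Kernel.const_apply] at h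
    exact h.symm

/-! ### Rescaling of the hypotheses -/

theorem map_withDensity_of_leftInverse {X Y : Type*} [MeasurableSpace X] [MeasurableSpace Y]
    {μ : Measure X} {f : X → ℝ≥0∞} (hf : Measurable f) {S : X → Y} {T : Y → X} (hS : Measurable S)
    (hT : Measurable T) (hTS : ∀ x, T (S x) = x) :
    (μ.withDensity f).map S = (μ.map S).withDensity (f ∘ T) := by
  ext E hE
  rw [Measure.map_apply hS hE, withDensity_apply _ (hS hE), withDensity_apply _ hE,
    setLIntegral_map hE (hf.comp hT) hS]
  simp [hTS]

theorem map_volume_inv_smul_sub {m : ℕ} (b : EuclideanSpace ℝ (Fin m)) {r : ℝ} (hr : 0 < r) :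
    (volume : Measure (EuclideanSpace ℝ (Fin m))).map (fun v => r⁻¹ • (v - b)) =
      ENNReal.ofReal (r ^ m) • volume := by
  have h1 : (fun v : EuclideanSpace ℝ (Fin m) => r⁻¹ • (v - b)) =
      (fun v => r⁻¹ • v) ∘ fun v => v - b := rfl
  rw [h1, ← Measure.map_map (measurable_const_smul _) (measurable_sub_const b),
    (measurePreserving_sub_right volume b).map_eq,
    Measure.map_addHaar_smul volume (inv_ne_zero hr.ne')]
  simp [abs_of_pos (pow_pos hr m)]

/-- Blow-ups of a Frostman measure on a ball belong to the normalized class. -/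
theorem rescale_mem_and_frostmanBound {n : ℕ} {s : ℝ} {ν : Measure (EuclideanSpace ℝ (Fin n))}
    [IsFiniteMeasure ν] (hν0 : ν ≠ 0) {a : EuclideanSpace ℝ (Fin n)} {r M : ℝ} (hr : 0 < r)
    (hM : 0 < M) (hν : ν (closedBall a r)ᶜ = 0)
    (hF : ∀ x ρ, 0 < ρ → ν (closedBall x ρ) ≤ ENNReal.ofReal (M * ρ ^ s)) :
    ENNReal.ofReal (M⁻¹ * r ^ (-s)) • ν.map (fun y => r⁻¹ • (y - a)) ∈
      compactlySupportedMeasures (closedBall (0 : EuclideanSpace ℝ (Fin n)) 1) ∧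
    FrostmanBound s (ENNReal.ofReal (M⁻¹ * r ^ (-s)) • ν.map fun y => r⁻¹ • (y - a)) := by
  set T : EuclideanSpace ℝ (Fin n) → EuclideanSpace ℝ (Fin n) := fun y => r⁻¹ • (y - a) with hT
  have hTm : Measurable T := by fun_prop
  set c : ℝ≥0∞ := ENNReal.ofReal (M⁻¹ * r ^ (-s)) with hc
  have hcpos : 0 < M⁻¹ * r ^ (-s) := by positivity
  have hc0 : c ≠ 0 := by simpa [hc] using hcpos
  have hball : ∀ x ρ, T ⁻¹' closedBall x ρ = closedBall (a + r • x) (r * ρ) := by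
    intro x ρ
    ext y
    simp only [mem_preimage, mem_closedBall, dist_eq_norm, hT]
    have : y - (a + r • x) = r • (r⁻¹ • (y - a) - x) := by
      rw [smul_sub, smul_inv_smul₀ hr.ne']; abel
    rw [this, norm_smul, Real.norm_of_nonneg hr.le, mul_le_mul_iff_right₀ hr]
  set ν' : Measure (EuclideanSpace ℝ (Fin n)) := c • ν.map T with hν'
  have hν'ball : ∀ x ρ, ν' (closedBall x ρ) = c * ν (closedBall (a + r • x) (r * ρ)) := by
    intro x ρ
    rw [hν', Measure.smul_apply, smul_eq_mul, Measure.map_apply hTm measurableSet_closedBall, hball]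
  constructor
  · have hsupp : ν'.support ⊆ closedBall 0 1 := by
      refine Measure.support_subset_of_isClosed isClosed_closedBall ?_
      rw [mem_ae_iff, hν', Measure.smul_apply,
        Measure.map_apply hTm measurableSet_closedBall.compl, preimage_compl, hball]
      simp [hν]
    refine ⟨?_, ?_, ?_, hsupp⟩
    · intro h0
      have := congrArg (fun ξ : Measure _ => ξ univ) h0
      simp only [hν', Measure.smul_apply, smul_eq_mul, Measure.map_apply hTm MeasurableSet.univ,
        preimage_univ, Measure.coe_zero, Pi.zero_apply, mul_eq_zero, hc0, false_or,
        Measure.measure_univ_eq_zero] at this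
      exact hν0 this
    · rw [hν', Measure.smul_apply, smul_eq_mul]
      exact ENNReal.mul_lt_top ENNReal.ofReal_lt_top (measure_lt_top _ _)
    · exact (isCompact_closedBall _ _).of_isClosed_subset Measure.isClosed_support hsupp
  · intro x ρ hρ
    rw [hν'ball]
    refine (mul_le_mul_right (hF _ _ (mul_pos hr hρ)) _).trans_eq ?_
    rw [hc, ← ENNReal.ofReal_mul hcpos.le]
    congr 1
    rw [Real.mul_rpow hr.le hρ.le, Real.rpow_neg hr.le]
    have := (Real.rpow_pos_of_pos hr s).ne'
    field_simp

/-- Rescaled form of the `L²` hypothesis: projections of a measure living on a ball of radius `r`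
have squared density norm of order `r ^ (2 s - m)`. -/
theorem lintegral_sq_density_le {n m : ℕ} {Λ : Type*} [MeasurableSpace Λ] {ω : Measure Λ}
    {P : Λ → EuclideanSpace ℝ (Fin n) →L[ℝ] EuclideanSpace ℝ (Fin m)} {s C : ℝ}
    (hL2 : ∀ μ ∈ compactlySupportedMeasures (closedBall (0 : EuclideanSpace ℝ (Fin n)) 1),
      FrostmanBound s μ →
        ∫⁻ l, ∫⁻ u, measureDeriv (μ.map (P l)) u ^ 2 ∂volume ∂ω ≤ ENNReal.ofReal C)
    (ν : Measure (EuclideanSpace ℝ (Fin n))) [IsFiniteMeasure ν] {a : EuclideanSpace ℝ (Fin n)}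
    {r M : ℝ} (hr : 0 < r) (hM : 0 < M) (hν : ν (closedBall a r)ᶜ = 0)
    (hF : ∀ x ρ, 0 < ρ → ν (closedBall x ρ) ≤ ENNReal.ofReal (M * ρ ^ s))
    {f : Λ → EuclideanSpace ℝ (Fin m) → ℝ≥0∞} (hf : ∀ l, Measurable (f l))
    (hfν : ∀ᵐ l ∂ω, ν.map (P l) = volume.withDensity (f l)) :
    ∫⁻ l, ∫⁻ u, f l u ^ 2 ∂volume ∂ω ≤ ENNReal.ofReal (M ^ 2 * r ^ (2 * s - m)) * ENNReal.ofReal C := by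
  -- The normalized class excludes the zero measure.
  rcases eq_or_ne ν 0 with rfl | hν0
  · refine le_of_eq_of_le ?_ bot_le
    rw [bot_eq_zero, lintegral_congr_ae (g := fun _ => 0) ?_, lintegral_zero]
    filter_upwards [hfν] with l hl
    rw [Measure.map_zero, eq_comm, withDensity_eq_zero_iff (hf l).aemeasurable] at hl
    rw [lintegral_congr_ae (g := fun _ => 0) ?_, lintegral_zero]
    filter_upwards [hl] with u hu
    simp [hu]
  set T : EuclideanSpace ℝ (Fin n) → EuclideanSpace ℝ (Fin n) := fun y => r⁻¹ • (y - a) with hT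
  have hTm : Measurable T := by fun_prop
  set c : ℝ≥0∞ := ENNReal.ofReal (M⁻¹ * r ^ (-s)) with hc
  have hcpos : 0 < M⁻¹ * r ^ (-s) := by positivity
  have hc0 : c ≠ 0 := by simpa [hc] using hcpos
  set ν' : Measure (EuclideanSpace ℝ (Fin n)) := c • ν.map T with hν'
  obtain ⟨hmem, hFr⟩ : ν' ∈ compactlySupportedMeasures (closedBall 0 1) ∧ FrostmanBound s ν' :=
    rescale_mem_and_frostmanBound hν0 hr hM hν hF
  set K : ℝ≥0∞ := ENNReal.ofReal (r ^ m) with hK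
  have hK0 : K ≠ 0 := by simpa [hK] using pow_pos hr m
  have hKt : K ≠ ∞ := ENNReal.ofReal_ne_top
  have hct : c ≠ ∞ := ENNReal.ofReal_ne_top
  -- The projection of `ν'` has density `c * K * f l (R u)`. Squaring gives `(c * K) ^ 2`, and the
  -- change of variables returns one factor `K`, leaving `c ^ 2 * K`.
  have key : ∀ᵐ l ∂ω, ∫⁻ u, f l u ^ 2 =
      (c ^ 2 * K)⁻¹ * ∫⁻ u, measureDeriv (ν'.map (P l)) u ^ 2 := by
    filter_upwards [hfν] with l hl
    set S : EuclideanSpace ℝ (Fin m) → EuclideanSpace ℝ (Fin m) := fun v => r⁻¹ • (v - P l a) with hS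
    set R : EuclideanSpace ℝ (Fin m) → EuclideanSpace ℝ (Fin m) := fun v => r • v + P l a with hR
    have hSm : Measurable S := by fun_prop
    have hRm : Measurable R := by fun_prop
    have hRS : ∀ x, R (S x) = x := by
      intro x; simp only [hR, hS]; rw [smul_inv_smul₀ hr.ne', sub_add_cancel]
    have hvol : (volume : Measure (EuclideanSpace ℝ (Fin m))).map S = K • volume :=
      map_volume_inv_smul_sub (P l a) hr
    have hPm : Measurable (P l) := (P l).continuous.measurable
    have hmap : ν'.map (P l) = volume.withDensity fun u => c * K * f l (R u) := by
      have hcomp : (P l) ∘ T = S ∘ (P l) := by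
        ext1 y; simp [hT, hS]
      rw [hν', Measure.map_smul, Measure.map_map hPm hTm, hcomp, ← Measure.map_map hSm hPm, hl,
        map_withDensity_of_leftInverse (hf l) hSm hRm hRS, hvol, withDensity_smul_measure,
        ← withDensity_smul _ ((hf l).comp hRm), ← withDensity_smul]
      · congr 1; ext u; simp [mul_assoc]
      · exact ((hf l).comp hRm).const_smul _
    have hgm : Measurable fun u => c * K * f l (R u) := ((hf l).comp hRm).const_mul _
    have hfinmeas : IsFiniteMeasure (volume.withDensity fun u => c * K * f l (R u)) := by
      have : IsFiniteMeasure ν' := ⟨hmem.2.1⟩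
      rw [← hmap]
      infer_instance
    have hD : ∫⁻ u, measureDeriv (ν'.map (P l)) u ^ 2 = (c * K) ^ 2 * ∫⁻ u, f l (R u) ^ 2 := by
      rw [hmap, ← lintegral_const_mul' _ _ (ENNReal.pow_ne_top (ENNReal.mul_ne_top hct hKt))]
      refine lintegral_congr_ae ?_
      filter_upwards [measureDeriv_withDensity hgm] with u hu
      rw [hu, mul_pow]
    have hchg : ∫⁻ u, f l u ^ 2 = K * ∫⁻ u, f l (R u) ^ 2 := by
      have h1 := lintegral_map (μ := volume) (f := fun u => f l (R u) ^ 2)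
        (((hf l).comp hRm).pow_const 2) hSm
      rw [hvol, lintegral_smul_measure] at h1
      simp only [hRS, smul_eq_mul] at h1
      exact h1.symm
    rw [hD, hchg, ← mul_assoc]
    congr 1
    rw [mul_pow, pow_two K, ← mul_assoc (c ^ 2), ← mul_assoc, ENNReal.inv_mul_cancel, one_mul]
    · exact mul_ne_zero (pow_ne_zero _ hc0) hK0
    · exact ENNReal.mul_ne_top (ENNReal.pow_ne_top hct) hKt
  have hcK : (c ^ 2 * K)⁻¹ = ENNReal.ofReal (M ^ 2 * r ^ (2 * s - m)) := by
    rw [hc, hK, ← ENNReal.ofReal_pow hcpos.le, ← ENNReal.ofReal_mul (by positivity),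
      ← ENNReal.ofReal_inv_of_pos (by positivity)]
    congr 1
    rw [Real.rpow_sub hr, Real.rpow_natCast, Real.rpow_neg hr.le, two_mul, Real.rpow_add hr]
    have := (Real.rpow_pos_of_pos hr s).ne'
    field_simp
  rw [lintegral_congr_ae key, lintegral_const_mul', hcK]
  · gcongr; exact hL2 ν' hmem hFr
  · rw [hcK]; exact ENNReal.ofReal_ne_top

/-- Rescaled form of the absolute continuity hypothesis. -/
theorem ae_map_absolutelyContinuous {n m : ℕ} {Λ : Type*} [MeasurableSpace Λ] {ω : Measure Λ}
    {P : Λ → EuclideanSpace ℝ (Fin n) →L[ℝ] EuclideanSpace ℝ (Fin m)} {s : ℝ}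
    (hac : ∀ μ ∈ compactlySupportedMeasures (closedBall (0 : EuclideanSpace ℝ (Fin n)) 1),
      FrostmanBound s μ → ∀ᵐ l ∂ω, μ.map (P l) ≪ volume)
    (ν : Measure (EuclideanSpace ℝ (Fin n))) [IsFiniteMeasure ν]
    {r M : ℝ} (hr : 0 < r) (hM : 0 < M) (hν : ν (closedBall 0 r)ᶜ = 0)
    (hF : ∀ x ρ, 0 < ρ → ν (closedBall x ρ) ≤ ENNReal.ofReal (M * ρ ^ s)) :
    ∀ᵐ l ∂ω, ν.map (P l) ≪ volume := by
  rcases eq_or_ne ν 0 with rfl | hν0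
  · simp [Measure.AbsolutelyContinuous.zero]
  obtain ⟨hmem, hFr⟩ := rescale_mem_and_frostmanBound hν0 hr hM hν hF
  filter_upwards [hac _ hmem hFr] with l hl
  have hPm : Measurable (P l) := (P l).continuous.measurable
  have hcpos : 0 < M⁻¹ * r ^ (-s) := by positivity
  refine Measure.AbsolutelyContinuous.mk fun N hN h0 => ?_
  have hRm : Measurable fun v : EuclideanSpace ℝ (Fin m) => r • v := measurable_const_smul r
  have hN' : volume ((fun v : EuclideanSpace ℝ (Fin m) => r • v) ⁻¹' N) = 0 := by
    rw [Measure.addHaar_preimage_smul volume hr.ne', h0, mul_zero]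
  have h1 := hl hN'
  rw [Measure.map_apply hPm (hRm hN), Measure.smul_apply, smul_eq_mul, mul_eq_zero] at h1
  rcases h1 with h1 | h1
  · exact absurd h1 (by simpa using hcpos)
  rw [Measure.map_apply (by fun_prop) (hPm (hRm hN))] at h1
  rw [Measure.map_apply hPm hN]
  convert h1 using 2
  ext y
  simp [smul_inv_smul₀ hr.ne']

/-! ### Energies of conditional measures and the lower bound -/

/-- The dyadic energy integral of a measure on a set covered by a family of balls. -/
theorem lintegral_measure_closedBall_le_tsum {X : Type*} [MetricSpace X] [MeasurableSpace X]
    [OpensMeasurableSpace X] (κ : Measure X) {K : Set X} {r : ℝ} (hr : 0 ≤ r) {u : Set X}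
    (hu : u.Countable)
    (hK : K ⊆ ⋃ x ∈ u, closedBall x (5 * r)) :
    ∫⁻ y, κ.restrict K (closedBall y r) ∂κ.restrict K ≤
      ∑' x : u, κ (closedBall (x : X) (6 * r)) ^ 2 := by
  have : Countable u := hu
  calc ∫⁻ y, κ.restrict K (closedBall y r) ∂κ.restrict K
      ≤ ∫⁻ y in K, κ (closedBall y r) ∂κ :=
        lintegral_mono fun y => Measure.restrict_apply_le K _
    _ ≤ ∫⁻ y in ⋃ x : u, closedBall (x : X) (5 * r), κ (closedBall y r) ∂κ :=
        lintegral_mono_set (by rwa [biUnion_eq_iUnion] at hK)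
    _ ≤ ∑' x : u, ∫⁻ y in closedBall (x : X) (5 * r), κ (closedBall y r) ∂κ :=
        lintegral_iUnion_le _ _
    _ ≤ ∑' x : u, κ (closedBall (x : X) (6 * r)) ^ 2 := by
        refine ENNReal.tsum_le_tsum fun x => ?_
        calc ∫⁻ y in closedBall (x : X) (5 * r), κ (closedBall y r) ∂κ
            ≤ ∫⁻ y in closedBall (x : X) (5 * r), κ (closedBall (x : X) (6 * r)) ∂κ := by
              refine setLIntegral_mono measurable_const fun y hy => measure_mono ?_
              refine closedBall_subset_closedBall' ?_
              rw [mem_closedBall] at hy; linarith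
          _ = κ (closedBall (x : X) (6 * r)) * κ (closedBall (x : X) (5 * r)) :=
              setLIntegral_const _ _
          _ ≤ _ := by
              rw [pow_two]
              gcongr
              norm_num

/-- Generic lower bound for the dimension of fibres over the carrier of a Frostman measure with
optimal covering numbers. -/
theorem exists_measurableSet_le_dimH_fiber {n m : ℕ} {Λ : Type*} [MeasurableSpace Λ]
    {ω : Measure Λ} [SFinite ω]
    {P : Λ → EuclideanSpace ℝ (Fin n) →L[ℝ] EuclideanSpace ℝ (Fin m)} {s C : ℝ}
    (hPm : Measurable fun p : Λ × EuclideanSpace ℝ (Fin n) => P p.1 p.2)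
    (hPn : ∀ l x, ‖P l x‖ ≤ ‖x‖)
    (hac : ∀ μ ∈ compactlySupportedMeasures (closedBall (0 : EuclideanSpace ℝ (Fin n)) 1),
      FrostmanBound s μ → ∀ᵐ l ∂ω, μ.map (P l) ≪ volume)
    (hL2 : ∀ μ ∈ compactlySupportedMeasures (closedBall (0 : EuclideanSpace ℝ (Fin n)) 1),
      FrostmanBound s μ →
        ∫⁻ l, ∫⁻ u, measureDeriv (μ.map (P l)) u ^ 2 ∂volume ∂ω ≤ ENNReal.ofReal C)
    (ν : Measure (EuclideanSpace ℝ (Fin n))) [IsFiniteMeasure ν]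
    {K : Set (EuclideanSpace ℝ (Fin n))} (hK : MeasurableSet K) (hνK : ν Kᶜ = 0)
    {R M : ℝ} (hR : 0 < R) (hM : 0 < M) (hKR : K ⊆ closedBall 0 R)
    (hF : ∀ x ρ, 0 < ρ → ν (closedBall x ρ) ≤ ENNReal.ofReal (M * ρ ^ s))
    {D : ℝ≥0∞} (hD : D ≠ ∞)
    (hcov : ∀ k : ℕ, ∃ u : Set (EuclideanSpace ℝ (Fin n)), u.Countable ∧
      K ⊆ ⋃ x ∈ u, closedBall x (5 * (1 / 2) ^ k) ∧
      ∑' _ : u, ENNReal.ofReal (((1 / 2) ^ k) ^ s) ≤ D)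
    {t : ℝ} (ht : 0 < t) (hts : t < s - m) :
    ∃ G : Set (Λ × EuclideanSpace ℝ (Fin m)), MeasurableSet G ∧
      (∀ᵐ l ∂ω, ∀ᵐ u ∂ν.map (P l), (l, u) ∈ G) ∧
      ∀ l u, (l, u) ∈ G → ENNReal.ofReal t ≤ dimH (P l ⁻¹' {u} ∩ K) := by
  -- The projections do not increase norms, so the image of `ν` lives in this ball; cutting off
  -- there yields the finite reference measure needed for the disintegration.
  set V : Measure (EuclideanSpace ℝ (Fin m)) := volume.restrict (closedBall 0 R) with hV
  have : IsFiniteMeasure V := ⟨by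
    rw [hV, Measure.restrict_apply_univ]; exact (isCompact_closedBall _ _).measure_lt_top⟩
  have hPl : ∀ l, Measurable (P l) := fun l => (P l).continuous.measurable
  have hνR : ν (closedBall 0 R)ᶜ = 0 := measure_mono_null (compl_subset_compl.2 hKR) hνK
  have hacV : ∀ᵐ l ∂ω, ν.map (P l) ≪ V := by
    filter_upwards [ae_map_absolutelyContinuous hac ν hR hM hνR hF] with l hl
    refine Measure.AbsolutelyContinuous.mk fun N hN h0 => ?_
    rw [hV, Measure.restrict_apply hN] at h0
    have h1 := hl h0
    rw [Measure.map_apply (hPl l) (hN.inter measurableSet_closedBall)] at h1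
    rw [Measure.map_apply (hPl l) hN]
    refine measure_mono_null (fun x hx => ?_) (measure_union_null h1 hνR)
    by_cases hxR : x ∈ closedBall (0 : EuclideanSpace ℝ (Fin n)) R
    · refine Or.inl ⟨hx, ?_⟩
      rw [mem_closedBall_zero_iff] at hxR ⊢
      exact (hPn l x).trans hxR
    · exact Or.inr hxR
  obtain ⟨κ, g, hκ, hg, hdis, hgV⟩ := exists_kernel_disintegration (P := fun l x => P l x) hPm ν V
  -- densities of the projections of pieces of `ν`
  have hdens : ∀ B : Set (EuclideanSpace ℝ (Fin n)), MeasurableSet B → ∀ᵐ l ∂ω,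
      (ν.restrict B).map (P l) = volume.withDensity
        ((closedBall 0 R).indicator fun u => κ (l, u) B * g (l, u)) := by
    intro B hB
    filter_upwards [hacV] with l hl
    have hκm : Measurable fun u => κ (l, u) B :=
      (Kernel.measurable_coe κ hB).comp measurable_prodMk_left
    have hgm : Measurable fun u => g (l, u) := hg.comp measurable_prodMk_left
    ext S hS
    rw [withDensity_indicator measurableSet_closedBall, ← hV, Measure.map_apply (hPl l) hS,
      Measure.restrict_apply (hPl l hS), withDensity_apply _ hS]
    have h1 := hdis l (S ×ˢ B) (hS.prod hB)
    have h2 : ∀ u, κ (l, u) (Prod.mk u ⁻¹' S ×ˢ B) = S.indicator (fun u => κ (l, u) B) u := by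
      intro u
      by_cases hu : u ∈ S <;> simp [hu]
    have h3 : {x | (P l x, x) ∈ S ×ˢ B} = P l ⁻¹' S ∩ B := rfl
    rw [h3, hgV l hl] at h1
    simp only [h2] at h1
    rw [h1, lintegral_indicator hS, restrict_withDensity hS,
      lintegral_withDensity_eq_lintegral_mul _ hgm hκm]
    simp [mul_comm]
  have hL2ball : ∀ (a : EuclideanSpace ℝ (Fin n)) (r : ℝ), 0 < r →
      ∫⁻ l, ∫⁻ u, (κ (l, u) (closedBall a r) * g (l, u)) ^ 2 ∂V ∂ω ≤
        ENNReal.ofReal (M ^ 2 * r ^ (2 * s - m)) * ENNReal.ofReal C := by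
    intro a r hr
    have hm : ∀ l, Measurable ((closedBall 0 R).indicator
        fun u => κ (l, u) (closedBall a r) * g (l, u)) := fun l =>
      (((Kernel.measurable_coe κ measurableSet_closedBall).comp measurable_prodMk_left).mul
        (hg.comp measurable_prodMk_left)).indicator measurableSet_closedBall
    refine le_of_eq_of_le ?_ (lintegral_sq_density_le hL2 (ν.restrict (closedBall a r)) (a := a)
      hr hM ?_ ?_ hm (hdens _ measurableSet_closedBall))
    · refine lintegral_congr fun l => ?_
      rw [hV, ← lintegral_indicator measurableSet_closedBall]
      refine lintegral_congr fun u => ?_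
      by_cases hu : u ∈ closedBall (0 : EuclideanSpace ℝ (Fin m)) R <;> simp [hu, indicator]
    · rw [Measure.restrict_apply measurableSet_closedBall.compl]; simp
    · exact fun x ρ hρ => (Measure.restrict_apply_le _ _).trans (hF x ρ hρ)
  -- the energies of the conditional measures
  set Q : ℕ → Λ × EuclideanSpace ℝ (Fin m) → ℝ≥0∞ := fun k p =>
    ∫⁻ y, (κ p).restrict K (closedBall y ((1 / 2) ^ k)) ∂(κ p).restrict K with hQ
  have hQm : ∀ k, Measurable (Q k) := by
    intro k
    have h := Kernel.measurable_coe (κ.restrict hK ×ₖ κ.restrict hK)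
      (measurableSet_dist_le (X := EuclideanSpace ℝ (Fin n)) ((1 / 2) ^ k))
    convert h using 1
    ext p
    rw [Kernel.prod_apply, Kernel.restrict_apply, Measure.prod_apply (measurableSet_dist_le _)]
    refine lintegral_congr fun y => ?_
    congr 1
    ext z
    simp [dist_comm]
  -- Each covering ball contributes order `r^(2s-m)` with `r = 2⁻ᵏ`; one factor `r^s` is absorbed by
  -- the covering number bound `D`, leaving `r^(s-m)`.
  have hQint : ∀ k, ∫⁻ l, ∫⁻ u, Q k (l, u) * g (l, u) ^ 2 ∂V ∂ω ≤
      D * (ENNReal.ofReal (M ^ 2 * 6 ^ (2 * s - m)) * ENNReal.ofReal C) *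
        ENNReal.ofReal (((1 / 2) ^ k) ^ (s - m)) := by
    intro k
    obtain ⟨u, huc, hKu, huD⟩ := hcov k
    have : Countable u := huc
    have hr : (0 : ℝ) < (1 / 2) ^ k := by positivity
    have hm : ∀ x : u, Measurable fun p =>
        (κ p (closedBall (x : EuclideanSpace ℝ (Fin n)) (6 * (1 / 2) ^ k)) * g p) ^ 2 := fun x =>
      ((Kernel.measurable_coe κ measurableSet_closedBall).mul hg).pow_const 2
    calc ∫⁻ l, ∫⁻ w, Q k (l, w) * g (l, w) ^ 2 ∂V ∂ω
        ≤ ∫⁻ l, ∫⁻ w, ∑' x : u, (κ (l, w) (closedBall (x : EuclideanSpace ℝ (Fin n))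
            (6 * (1 / 2) ^ k)) * g (l, w)) ^ 2 ∂V ∂ω := by
          refine lintegral_mono fun l => lintegral_mono fun w => ?_
          simp only [mul_pow, ENNReal.tsum_mul_right]
          gcongr
          exact lintegral_measure_closedBall_le_tsum _ hr.le huc hKu
      _ = ∑' x : u, ∫⁻ l, ∫⁻ w, (κ (l, w) (closedBall (x : EuclideanSpace ℝ (Fin n))
            (6 * (1 / 2) ^ k)) * g (l, w)) ^ 2 ∂V ∂ω := by
          rw [← lintegral_tsum fun x => (hm x).lintegral_prod_right'.aemeasurable]
          refine lintegral_congr fun l => ?_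
          have hml : ∀ x : u, AEMeasurable (fun w => (κ (l, w) (closedBall
            (x : EuclideanSpace ℝ (Fin n)) (6 * (1 / 2) ^ k)) * g (l, w)) ^ 2) V :=
            fun x => ((hm x).comp measurable_prodMk_left).aemeasurable
          exact lintegral_tsum hml
      _ ≤ ∑' _ : u, ENNReal.ofReal (M ^ 2 * (6 * (1 / 2) ^ k) ^ (2 * s - m)) *
            ENNReal.ofReal C := ENNReal.tsum_le_tsum fun x => hL2ball _ _ (by positivity)
      _ = ∑' _ : u, ENNReal.ofReal (((1 / 2) ^ k) ^ s) *
            (ENNReal.ofReal (M ^ 2 * 6 ^ (2 * s - m)) * ENNReal.ofReal C *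
              ENNReal.ofReal (((1 / 2) ^ k) ^ (s - m))) := by
          congr 1; ext x
          have h1 : M ^ 2 * (6 * (1 / 2) ^ k) ^ (2 * s - m) = ((1 / 2) ^ k) ^ s *
              (M ^ 2 * 6 ^ (2 * s - m)) * ((1 / 2) ^ k) ^ (s - m) := by
            rw [Real.mul_rpow (by norm_num) hr.le]
            nth_rewrite 2 [show 2 * s - (m : ℝ) = s + (s - m) by ring]
            rw [Real.rpow_add hr]
            ring
          rw [h1, ENNReal.ofReal_mul (by positivity), ENNReal.ofReal_mul (by positivity)]
          ring
      _ ≤ _ := by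
          rw [ENNReal.tsum_mul_right, ← mul_assoc]
          gcongr
  set F : Λ × EuclideanSpace ℝ (Fin m) → ℝ≥0∞ := fun p =>
    ∑' k : ℕ, ENNReal.ofReal (((1 / 2) ^ k) ^ (-t)) * Q k p with hFdef
  have hFm : Measurable F := Measurable.tsum fun k => (hQm k).const_mul _
  -- The bound is a geometric series of ratio `2^(-(s-m-t))`, less than 1 because `t < s - m`.
  have hFint : ∫⁻ l, ∫⁻ u, F (l, u) * g (l, u) ^ 2 ∂V ∂ω ≠ ∞ := by
    set E : ℝ≥0∞ := D * (ENNReal.ofReal (M ^ 2 * 6 ^ (2 * s - m)) * ENNReal.ofReal C) with hE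
    have hEt : E ≠ ∞ := ENNReal.mul_ne_top hD
      (ENNReal.mul_ne_top ENNReal.ofReal_ne_top ENNReal.ofReal_ne_top)
    set q : ℝ≥0∞ := ENNReal.ofReal ((1 / 2) ^ (s - m - t)) with hq
    have hq1 : q < 1 := by
      rw [hq, ← ENNReal.ofReal_one]
      exact (ENNReal.ofReal_lt_ofReal_iff one_pos).2
        (Real.rpow_lt_one (by norm_num) (by norm_num) (by linarith))
    have hmk : ∀ k, Measurable fun p =>
        ENNReal.ofReal (((1 / 2) ^ k) ^ (-t)) * (Q k p * g p ^ 2) := fun k =>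
      ((hQm k).mul (hg.pow_const 2)).const_mul _
    have h1 : ∫⁻ l, ∫⁻ u, F (l, u) * g (l, u) ^ 2 ∂V ∂ω =
        ∑' k : ℕ, ENNReal.ofReal (((1 / 2) ^ k) ^ (-t)) *
          ∫⁻ l, ∫⁻ u, Q k (l, u) * g (l, u) ^ 2 ∂V ∂ω := by
      calc _ = ∑' k : ℕ, ∫⁻ l, ∫⁻ u, ENNReal.ofReal (((1 / 2) ^ k) ^ (-t)) *
            (Q k (l, u) * g (l, u) ^ 2) ∂V ∂ω := by
            rw [← lintegral_tsum fun k => (hmk k).lintegral_prod_right'.aemeasurable]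
            refine lintegral_congr fun l => ?_
            have hml : ∀ k, AEMeasurable (fun u => ENNReal.ofReal (((1 / 2) ^ k) ^ (-t)) *
                (Q k (l, u) * g (l, u) ^ 2)) V :=
              fun k => ((hmk k).comp measurable_prodMk_left).aemeasurable
            rw [← lintegral_tsum hml]
            refine lintegral_congr fun u => ?_
            rw [hFdef, ← ENNReal.tsum_mul_right]
            simp only [mul_assoc]
        _ = _ := by
            simp only [lintegral_const_mul' _ _ ENNReal.ofReal_ne_top]
    rw [h1]
    refine ne_top_of_le_ne_top (b := ∑' k : ℕ, E * q ^ k) ?_ (ENNReal.tsum_le_tsum fun k => ?_)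
    · rw [ENNReal.tsum_mul_left, ENNReal.tsum_geometric]
      exact ENNReal.mul_ne_top hEt (ENNReal.inv_ne_top.2 (tsub_pos_of_lt hq1).ne')
    · have hr : (0 : ℝ) < (1 / 2) ^ k := by positivity
      calc _ ≤ ENNReal.ofReal (((1 / 2) ^ k) ^ (-t)) *
            (E * ENNReal.ofReal (((1 / 2) ^ k) ^ (s - m))) := by gcongr; exact hQint k
        _ = E * q ^ k := by
            rw [mul_left_comm, ← ENNReal.ofReal_mul (by positivity), ← Real.rpow_add hr, hq,
              ← ENNReal.ofReal_pow (by positivity), ← Real.rpow_natCast, ← Real.rpow_mul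
              (by norm_num), ← Real.rpow_natCast, ← Real.rpow_mul (by norm_num)]
            ring_nf
  set W : Set ((Λ × EuclideanSpace ℝ (Fin m)) × EuclideanSpace ℝ (Fin n)) :=
    {p | p.2 ∈ K ∧ P p.1.1 p.2 = p.1.2} with hW
  have hWm : MeasurableSet W := (measurable_snd hK).inter (measurableSet_eq_fun
    (hPm.comp (measurable_fst.fst.prodMk measurable_snd)) measurable_fst.snd)
  -- At such a pair the conditional measure has finite `t`-energy and charges the part of the fibre
  -- inside `K`, which suffices for the dimension bound.
  refine ⟨{p | F p ≠ ∞ ∧ κ p (Prod.mk p ⁻¹' W) ≠ 0}, ?_, ?_, ?_⟩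
  · exact (measurableSet_eq_fun hFm measurable_const).compl.inter (measurableSet_eq_fun
      (Kernel.measurable_kernel_prodMk_left hWm) measurable_const).compl
  · have hFg : Measurable fun p => F p * g p ^ 2 := hFm.mul (hg.pow_const 2)
    filter_upwards [hacV, ae_lt_top hFg.lintegral_prod_right' hFint] with l hl hlF
    have hm1 : Measurable fun u => F (l, u) * g (l, u) ^ 2 := hFg.comp measurable_prodMk_left
    have hgm : Measurable fun u => g (l, u) := hg.comp measurable_prodMk_left
    -- The weight `g ^ 2` is harmless: `g` is nonzero almost everywhere for the projected measure,
    -- whose density it is.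
    have h1 : ∀ᵐ u ∂ν.map (P l), F (l, u) ≠ ∞ := by
      rw [hgV l hl, ae_withDensity_iff hgm]
      filter_upwards [ae_lt_top hm1 hlF.ne] with u hu hgu hFu
      rw [hFu, ENNReal.top_mul (pow_ne_zero 2 hgu)] at hu
      exact lt_irrefl _ hu
    have h2 : ∀ᵐ u ∂ν.map (P l), κ (l, u) (Prod.mk (l, u) ⁻¹' W)ᶜ = 0 := by
      have hS : MeasurableSet {p : EuclideanSpace ℝ (Fin m) × EuclideanSpace ℝ (Fin n) |
          ((l, p.1), p.2) ∈ W}ᶜ :=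
        (((measurable_const.prodMk measurable_fst).prodMk measurable_snd) hWm).compl
      have h3 := hdis l _ hS
      have h4 : ν {x | (P l x, x) ∈ {p : EuclideanSpace ℝ (Fin m) × EuclideanSpace ℝ (Fin n) |
          ((l, p.1), p.2) ∈ W}ᶜ} = 0 := by
        refine measure_mono_null (t := Kᶜ) (fun x hx hxK => hx ?_) hνK
        exact ⟨hxK, rfl⟩
      rw [h4, eq_comm, lintegral_eq_zero_iff] at h3
      · exact h3
      · exact (Kernel.measurable_kernel_prodMk_left (κ := κ.sectR l) hS)
    filter_upwards [h1, h2] with u hu1 hu2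
    refine ⟨hu1, fun h0 => ?_⟩
    have hc := measure_union_null h0 hu2
    rw [union_compl_self, measure_univ] at hc
    exact one_ne_zero hc
  · rintro l u ⟨hFu, hWu⟩
    refine le_dimH_of_tsum_lintegral_closedBall (κ := (κ (l, u)).restrict K) ht hFu ?_
    rw [Measure.restrict_apply' hK]
    intro h0
    refine hWu (measure_mono_null (fun x hx => ?_) h0)
    exact ⟨⟨hx.2, hx.1⟩, hx.1⟩

theorem IsOrthogonalProj.norm_apply_le {n m : ℕ}
    {P : EuclideanSpace ℝ (Fin n) →L[ℝ] EuclideanSpace ℝ (Fin m)} (hP : IsOrthogonalProj P)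
    (x : EuclideanSpace ℝ (Fin n)) : ‖P x‖ ≤ ‖x‖ := by
  obtain ⟨V, e, he⟩ := hP
  rw [he, LinearIsometryEquiv.norm_map]
  exact V.norm_orthogonalProjectionOnto_apply_le x

/-! ### Exhaustion by dyadically regular sets -/

/-- Carathéodory measurable sets of finite measure are null measurable. -/
theorem nullMeasurableSet_of_isCaratheodory {X : Type*} [MeasurableSpace X] {μ : Measure X}
    {A : Set X} (hA : μ.toOuterMeasure.IsCaratheodory A) (hfin : μ A ≠ ∞) :
    NullMeasurableSet A μ := by
  have h := hA (toMeasurable μ A)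
  simp only [Measure.coe_toOuterMeasure] at h
  rw [inter_eq_self_of_subset_right (subset_toMeasurable μ A), measure_toMeasurable] at h
  have h0 : μ (toMeasurable μ A \ A) = 0 :=
    (ENNReal.add_right_inj hfin).1 (by rw [← h, add_zero])
  refine (measurableSet_toMeasurable μ A).nullMeasurableSet.congr ?_
  exact ae_eq_set.2 ⟨h0, by simp [sdiff_eq_empty.2 (subset_toMeasurable μ A)]⟩

/-- Points at which a measure is `s`-regular with constant `c` on all dyadic scales. -/
def dyadicRegularSet {X : Type*} [PseudoMetricSpace X] [MeasurableSpace X] (μ : Measure X)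
    (s : ℝ) (c : ℝ≥0∞) : Set X :=
  {x | ∀ k : ℕ, ENNReal.ofReal (((1 / 2) ^ k) ^ s) ≤ c * μ (closedBall x ((1 / 2) ^ k)) ∧
    μ (closedBall x ((1 / 2) ^ k)) ≤ c * ENNReal.ofReal (((1 / 2) ^ k) ^ s)}

theorem dyadicRegularSet_mono {X : Type*} [PseudoMetricSpace X] [MeasurableSpace X]
    {μ : Measure X} {s : ℝ} {c d : ℝ≥0∞} (h : c ≤ d) :
    dyadicRegularSet μ s c ⊆ dyadicRegularSet μ s d := fun _ hx k =>
  ⟨(hx k).1.trans (by gcongr), (hx k).2.trans (by gcongr)⟩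

theorem measurableSet_dyadicRegularSet {X : Type*} [MetricSpace X] [MeasurableSpace X]
    [BorelSpace X] [SecondCountableTopology X] (μ : Measure X) [SFinite μ] (s : ℝ) (c : ℝ≥0∞) :
    MeasurableSet (dyadicRegularSet μ s c) := by
  have : dyadicRegularSet μ s c = ⋂ k : ℕ, {x | ENNReal.ofReal (((1 / 2) ^ k) ^ s) ≤
      c * μ (closedBall x ((1 / 2) ^ k)) ∧
      μ (closedBall x ((1 / 2) ^ k)) ≤ c * ENNReal.ofReal (((1 / 2) ^ k) ^ s)} := by
    ext x; simp [dyadicRegularSet]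
  rw [this]
  refine MeasurableSet.iInter fun k => ?_
  have h := measurable_measure_closedBall μ ((1 / 2) ^ k)
  exact (measurableSet_le measurable_const (h.const_mul c)).inter
    (measurableSet_le h measurable_const)

/-- Only finitely many coarse scales escape the eventual bounds. There monotonicity supplies the
lower bound from the ball of scale `k₀`, and the total mass the upper one, at the price of the
factor `a`. -/
theorem exists_mem_dyadicRegularSet {X : Type*} [PseudoMetricSpace X] [MeasurableSpace X]
    {μ : Measure X} [IsFiniteMeasure μ] {s : ℝ} (hs : 0 ≤ s) {x : X} {c : ℝ≥0∞} (hc : c ≠ 0)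
    (hlow : ∀ᶠ k : ℕ in atTop,
      c * ENNReal.ofReal (((1 / 2) ^ k) ^ s) ≤ μ (closedBall x ((1 / 2) ^ k)))
    {M : ℕ} (hup : ∀ᶠ k : ℕ in atTop,
      μ (closedBall x ((1 / 2) ^ k)) ≤ M * ENNReal.ofReal (((1 / 2) ^ k) ^ s)) :
    ∃ j : ℕ, x ∈ dyadicRegularSet μ s j := by
  obtain ⟨k₀, hk₀⟩ := eventually_atTop.1 (hlow.and hup)
  have hpos : ∀ k : ℕ, 0 < ENNReal.ofReal (((1 / 2) ^ k) ^ s) := fun k =>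
    ENNReal.ofReal_pos.2 (by positivity)
  have hle1 : ∀ k : ℕ, ENNReal.ofReal (((1 / 2) ^ k) ^ s) ≤ 1 := fun k =>
    ENNReal.ofReal_le_one.2 (Real.rpow_le_one (by positivity)
      (pow_le_one₀ (by norm_num) (by norm_num)) hs)
  set a : ℝ≥0∞ := ENNReal.ofReal (((1 / 2) ^ k₀) ^ s) with ha
  have ha0 : a ≠ 0 := (hpos k₀).ne'
  have hat : a ≠ ∞ := ENNReal.ofReal_ne_top
  have hlow' : ∀ k : ℕ, c * a * ENNReal.ofReal (((1 / 2) ^ k) ^ s) ≤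
      μ (closedBall x ((1 / 2) ^ k)) := by
    intro k
    rcases le_total k₀ k with h | h
    · refine le_trans ?_ (hk₀ k h).1
      gcongr
      exact mul_le_of_le_one_right' (hle1 k₀)
    · refine le_trans (mul_le_of_le_one_right' (hle1 k)) ((hk₀ k₀ le_rfl).1.trans ?_)
      exact measure_mono (closedBall_subset_closedBall
        (pow_le_pow_of_le_one (by norm_num) (by norm_num) h))
  have hup' : ∀ k : ℕ, μ (closedBall x ((1 / 2) ^ k)) ≤
      (M + μ univ / a) * ENNReal.ofReal (((1 / 2) ^ k) ^ s) := by
    intro k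
    rcases le_total k₀ k with h | h
    · refine (hk₀ k h).2.trans ?_
      gcongr; exact le_self_add
    · calc μ (closedBall x ((1 / 2) ^ k)) ≤ μ univ := measure_mono (subset_univ _)
        _ = μ univ / a * a := (ENNReal.div_mul_cancel ha0 hat).symm
        _ ≤ _ := by
          gcongr
          · exact le_add_self
          · rw [ha]
            exact ENNReal.ofReal_le_ofReal (Real.rpow_le_rpow (by positivity)
              (pow_le_pow_of_le_one (by norm_num) (by norm_num) h) hs)
  have hfin : (c * a)⁻¹ + (M + μ univ / a) ≠ ∞ := by
    refine ENNReal.add_ne_top.2 ⟨ENNReal.inv_ne_top.2 (mul_ne_zero hc ha0), ?_⟩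
    exact ENNReal.add_ne_top.2 ⟨ENNReal.natCast_ne_top M,
      ENNReal.div_ne_top (measure_ne_top μ univ) ha0⟩
  obtain ⟨j, hj⟩ := ENNReal.exists_nat_gt hfin
  refine ⟨j, dyadicRegularSet_mono hj.le fun k => ⟨?_, (hup' k).trans ?_⟩⟩
  · have hca : c * a ≠ 0 := mul_ne_zero hc ha0
    -- Only `c ≠ 0` is assumed; `c = ∞` is excluded because `μ` is finite.
    have hcat : c * a ≠ ∞ := by
      intro h
      have h1 := hlow' 0
      rw [h, ENNReal.top_mul (hpos 0).ne', top_le_iff] at h1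
      exact measure_ne_top _ _ h1
    calc ENNReal.ofReal (((1 / 2) ^ k) ^ s)
        = (c * a)⁻¹ * (c * a * ENNReal.ofReal (((1 / 2) ^ k) ^ s)) := by
          rw [← mul_assoc, ENNReal.inv_mul_cancel hca hcat, one_mul]
      _ ≤ _ := mul_le_mul' le_self_add (hlow' k)
  · exact mul_le_mul_left (le_add_self (a := (M : ℝ≥0∞) + μ univ / a)) _

/-- The restriction of a measure to a subset of its dyadically regular set is Frostman. -/
theorem exists_frostman_const {X : Type*} [PseudoMetricSpace X] [MeasurableSpace X]
    [OpensMeasurableSpace X] {μ : Measure X} [IsFiniteMeasure μ] {s : ℝ} (hs : 0 ≤ s) {j : ℕ}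
    {K : Set X} (hK : K ⊆ dyadicRegularSet μ s j) :
    ∃ M : ℝ, 0 < M ∧ ∀ x ρ, 0 < ρ → μ.restrict K (closedBall x ρ) ≤ ENNReal.ofReal (M * ρ ^ s) := by
  -- The inner `2 ^ s` comes from dyadic radii, the outer one from recentring at a point of `K` with
  -- doubled radius. The total mass handles `2 * ρ ≥ 1`, and the 1 ensures positivity.
  refine ⟨(j * 2 ^ s + (μ univ).toReal + 1) * 2 ^ s, by positivity, fun x ρ hρ => ?_⟩
  rw [Measure.restrict_apply measurableSet_closedBall]
  rcases (closedBall x ρ ∩ K).eq_empty_or_nonempty with h | ⟨y, hyx, hyK⟩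
  · simp [h]
  have hρ2 : 0 < 2 * ρ := by positivity
  have hsub : closedBall x ρ ∩ K ⊆ closedBall y (2 * ρ) := fun z hz => by
    rw [mem_closedBall] at hyx ⊢
    have := mem_closedBall.1 hz.1
    have := dist_triangle_right z y x
    linarith
  refine (measure_mono hsub).trans ?_
  have hmain : μ (closedBall y (2 * ρ)) ≤
      ENNReal.ofReal ((j * 2 ^ s + (μ univ).toReal) * (2 * ρ) ^ s) := by
    rcases le_total (2 * ρ) 1 with h | h
    · refine (measure_closedBall_le_of_dyadic hs (k₀ := 0) (fun k _ => (hK hyK k).2) hρ2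
        (by simpa using h)).trans ?_
      rw [← ENNReal.ofReal_natCast, ← ENNReal.ofReal_mul (by positivity),
        ← ENNReal.ofReal_mul (by positivity)]
      refine ENNReal.ofReal_le_ofReal ?_
      gcongr
      exact le_add_of_nonneg_right ENNReal.toReal_nonneg
    · refine (measure_mono (subset_univ _)).trans ?_
      rw [← ENNReal.ofReal_toReal (measure_ne_top μ univ)]
      refine ENNReal.ofReal_le_ofReal ?_
      rw [ENNReal.toReal_ofReal ENNReal.toReal_nonneg]
      have h1 : 1 ≤ (2 * ρ) ^ s := Real.one_le_rpow h hs
      have h2 : (0 : ℝ) ≤ j * 2 ^ s := by positivity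
      have h3 : 0 ≤ (μ univ).toReal := ENNReal.toReal_nonneg
      nlinarith
  refine hmain.trans (ENNReal.ofReal_le_ofReal ?_)
  have h0 : 0 ≤ (2 : ℝ) ^ s * ρ ^ s := by positivity
  rw [Real.mul_rpow (by norm_num) hρ.le]
  linarith

/-- Optimal covering numbers of dyadically regular sets. -/
theorem exists_cover_of_subset_dyadicRegularSet {X : Type*} [MetricSpace X] [MeasurableSpace X]
    [BorelSpace X] {μ : Measure X} [IsFiniteMeasure μ] {s : ℝ} {j : ℕ} (hj : j ≠ 0) {K : Set X}
    (hK : K ⊆ dyadicRegularSet μ s j) (k : ℕ) :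
    ∃ u : Set X, u.Countable ∧ K ⊆ ⋃ x ∈ u, closedBall x (5 * (1 / 2) ^ k) ∧
      ∑' _ : u, ENNReal.ofReal (((1 / 2) ^ k) ^ s) ≤ j * μ univ := by
  have hj0 : (j : ℝ≥0∞) ≠ 0 := by exact_mod_cast hj
  have hjt : (j : ℝ≥0∞) ≠ ∞ := ENNReal.natCast_ne_top j
  obtain ⟨u, huc, hKu, hu⟩ := exists_cover_closedBall_of_le_measure (μ := μ) (K := K)
    (c := (j : ℝ≥0∞)⁻¹ * ENNReal.ofReal (((1 / 2) ^ k) ^ s)) (r := (1 / 2) ^ k)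
    (mul_ne_zero (ENNReal.inv_ne_zero.2 hjt) (ENNReal.ofReal_pos.2 (by positivity)).ne')
    (by positivity) (fun x hx => by
      calc (j : ℝ≥0∞)⁻¹ * ENNReal.ofReal (((1 / 2) ^ k) ^ s)
          ≤ (j : ℝ≥0∞)⁻¹ * (j * μ (closedBall x ((1 / 2) ^ k))) := by gcongr; exact (hK hx k).1
        _ = _ := by rw [← mul_assoc, ENNReal.inv_mul_cancel hj0 hjt, one_mul])
  refine ⟨u, huc, hKu, ?_⟩
  rw [ENNReal.tsum_mul_left] at hu
  calc ∑' _ : u, ENNReal.ofReal (((1 / 2) ^ k) ^ s)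
      = j * ((j : ℝ≥0∞)⁻¹ * ∑' _ : u, ENNReal.ofReal (((1 / 2) ^ k) ^ s)) := by
        rw [← mul_assoc, ENNReal.mul_inv_cancel hj0 hjt, one_mul]
    _ ≤ _ := by gcongr

/-- Positive lower density gives a lower bound on dyadic balls. -/
theorem exists_le_measure_closedBall_of_lowerDensity_pos {n : ℕ} {s : ℝ} (hs : 0 ≤ s)
    {A : Set (EuclideanSpace ℝ (Fin n))} {x : EuclideanSpace ℝ (Fin n)}
    (h : 0 < lowerDensity s A x) :
    ∃ c : ℝ≥0∞, c ≠ 0 ∧ ∀ᶠ k : ℕ in atTop, c * ENNReal.ofReal (((1 / 2) ^ k) ^ s) ≤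
      (μH[s] : Measure (EuclideanSpace ℝ (Fin n))).restrict A (closedBall x ((1 / 2) ^ k)) := by
  obtain ⟨c, hc0, hc⟩ := exists_between h
  have hev := eventually_lt_of_lt_liminf hc
  have hlim : Tendsto (fun k : ℕ => (1 / 2 : ℝ) ^ k) atTop (𝓝[>] 0) :=
    tendsto_nhdsWithin_iff.2 ⟨tendsto_pow_atTop_nhds_zero_of_lt_one (by norm_num) (by norm_num),
      Eventually.of_forall fun k => by simp⟩
  refine ⟨c, hc0.ne', ?_⟩
  filter_upwards [hlim.eventually hev] with k hk
  have hr : (0 : ℝ) < (1 / 2) ^ k := by positivity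
  rw [Measure.restrict_apply measurableSet_closedBall, inter_comm]
  -- The density is normalized by `(2r)^s ≥ r^s`, so the same `c` works.
  calc c * ENNReal.ofReal (((1 / 2) ^ k) ^ s)
      ≤ ENNReal.ofReal ((2 * (1 / 2) ^ k) ^ (-s)) * μH[s] (A ∩ closedBall x ((1 / 2) ^ k)) *
          ENNReal.ofReal ((2 * (1 / 2) ^ k) ^ s) := by
        gcongr
        linarith
    _ = μH[s] (A ∩ closedBall x ((1 / 2) ^ k)) := by
        rw [mul_right_comm, ← ENNReal.ofReal_mul (by positivity),
          ← Real.rpow_add (by positivity)]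
        simp

/-- A set of positive lower density is exhausted, up to a null set, by bounded Borel subsets of its
dyadically regular sets. -/
theorem exists_exhaustion_dyadicRegularSet {n : ℕ} {s : ℝ} (hs : 0 < s)
    {A : Set (EuclideanSpace ℝ (Fin n))}
    (hA : NullMeasurableSet A (μH[s] : Measure (EuclideanSpace ℝ (Fin n))))
    (hA_fin : (μH[s] : Measure (EuclideanSpace ℝ (Fin n))) A < ∞)
    (hA_dens : ∀ᵐ x ∂(μH[s] : Measure (EuclideanSpace ℝ (Fin n))),
      x ∈ A → 0 < lowerDensity s A x) :
    ∃ K : ℕ → Set (EuclideanSpace ℝ (Fin n)), (∀ j, MeasurableSet (K j)) ∧ (∀ j, K j ⊆ A) ∧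
      (∀ j, K j ⊆ closedBall 0 (j + 1)) ∧
      (∀ j, K j ⊆ dyadicRegularSet ((μH[s] : Measure _).restrict A) s (j + 1 : ℕ)) ∧
      ∀ᵐ x ∂(μH[s] : Measure (EuclideanSpace ℝ (Fin n))).restrict A, ∃ j, x ∈ K j := by
  obtain ⟨A₀, hA₀, hA₀m, hA₀ae⟩ := hA.exists_measurable_subset_ae_eq
  set μ := (μH[s] : Measure (EuclideanSpace ℝ (Fin n))).restrict A with hμ
  have : IsFiniteMeasure μ := ⟨by rwa [hμ, Measure.restrict_apply_univ]⟩
  -- Regularity refers to the measure on all of `A`; only the sets themselves are cut down to the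
  -- Borel subset `A₀`. The shift to `j + 1` keeps radius and constant positive.
  refine ⟨fun j => A₀ ∩ closedBall 0 (j + 1) ∩ dyadicRegularSet μ s (j + 1 : ℕ),
    fun j => (hA₀m.inter measurableSet_closedBall).inter (measurableSet_dyadicRegularSet _ _ _),
    fun j x hx => hA₀ hx.1.1, fun j x hx => hx.1.2, fun j x hx => hx.2, ?_⟩
  have h1 : ∀ᵐ x ∂μ, x ∈ A₀ := by
    rw [hμ, ← Measure.restrict_congr_set hA₀ae]
    exact ae_restrict_mem hA₀m
  filter_upwards [h1, ae_restrict_of_ae hA_dens,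
    ae_restrict_of_ae (ae_exists_measure_closedBall_le μ hs)] with x hx hd ⟨M, hM⟩
  obtain ⟨c, hc0, hc⟩ := exists_le_measure_closedBall_of_lowerDensity_pos hs.le (hd (hA₀ hx))
  obtain ⟨j, hj⟩ := exists_mem_dyadicRegularSet hs.le hc0 hc hM
  obtain ⟨i, hi⟩ := exists_nat_ge ‖x‖
  refine ⟨max i j, ⟨hx, ?_⟩, dyadicRegularSet_mono ?_ hj⟩
  · rw [mem_closedBall_zero_iff]
    refine hi.trans ?_
    have : (i : ℝ) ≤ (max i j : ℕ) := by exact_mod_cast le_max_left i j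
    linarith
  · exact_mod_cast (le_max_right i j).trans (Nat.le_succ _)

/-! ### Combination of the two bounds -/

theorem mainTheorem1 {n m : ℕ} {Λ : Type*} [MetricSpace Λ] [CompactSpace Λ]
    [MeasurableSpace Λ] [BorelSpace Λ]
    (ω : Measure Λ) [IsFiniteMeasure ω] (hω : ω ≠ 0)
    (P : Λ → EuclideanSpace ℝ (Fin n) →L[ℝ] EuclideanSpace ℝ (Fin m))
    (hP : ∀ l, IsOrthogonalProj (P l))
    (hPcont : ∀ x, Continuous fun l => P l x)
    (s : ℝ) (hs : (m : ℝ) < s)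
    (hac : ∀ μ ∈ compactlySupportedMeasures (Metric.closedBall (0 : EuclideanSpace ℝ (Fin n)) 1),
      FrostmanBound s μ → ∀ᵐ l ∂ω, μ.map (P l) ≪ volume)
    (hL2 : ∃ C : ℝ, 0 < C ∧
      ∀ μ ∈ compactlySupportedMeasures (Metric.closedBall (0 : EuclideanSpace ℝ (Fin n)) 1),
        FrostmanBound s μ →
          ∫⁻ l, ∫⁻ u, measureDeriv (μ.map (P l)) u ^ 2 ∂volume ∂ω < ENNReal.ofReal C)
    (A : Set (EuclideanSpace ℝ (Fin n)))
    (hA : (μH[s] : Measure (EuclideanSpace ℝ (Fin n))).toOuterMeasure.IsCaratheodory A)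
    (hA_pos : 0 < μH[s] A) (hA_fin : μH[s] A < ∞)
    (hA_dens : ∀ᵐ x ∂(μH[s] : Measure (EuclideanSpace ℝ (Fin n))),
      x ∈ A → 0 < lowerDensity s A x) :
    (∀ᵐ p ∂(((μH[s] : Measure (EuclideanSpace ℝ (Fin n))).restrict A).prod ω),
      dimH (P p.2 ⁻¹' {P p.2 p.1} ∩ A) = ENNReal.ofReal (s - m)) ∧
    (∀ᵐ l ∂ω, 0 < (volume : Measure (EuclideanSpace ℝ (Fin m)))
      {u | dimH (P l ⁻¹' {u} ∩ A) = ENNReal.ofReal (s - m)}) := by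
  obtain ⟨C, -, hC⟩ := hL2
  have hs0 : 0 < s := (Nat.cast_nonneg m).trans_lt hs
  have hd0 : 0 < s - m := sub_pos.2 hs
  have hPl : ∀ l, Measurable (P l) := fun l => (P l).continuous.measurable
  have hPm : Measurable fun p : Λ × EuclideanSpace ℝ (Fin n) => P p.1 p.2 :=
    measurable_uncurry_of_continuous_of_measurable (u := fun l x => P l x) hPcont hPl
  have hPn : ∀ l x, ‖P l x‖ ≤ ‖x‖ := fun l => (hP l).norm_apply_le
  obtain ⟨N, hNm, hNnull, hN⟩ := exists_measurableSet_dimH_fiber_le (P := fun l x => P l x)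
    (fun x => (hPcont x).measurable)
    (fun l x y => by rw [dist_eq_norm, dist_eq_norm, ← map_sub]; exact hPn l _) hs hA_fin.ne
  obtain ⟨K, hKm, hKA, hKball, hKreg, hKae⟩ := exists_exhaustion_dyadicRegularSet hs0
    (nullMeasurableSet_of_isCaratheodory hA hA_fin.ne) hA_fin hA_dens
  set μ := (μH[s] : Measure (EuclideanSpace ℝ (Fin n))).restrict A with hμ
  have : IsFiniteMeasure μ := ⟨by rwa [hμ, Measure.restrict_apply_univ]⟩
  have hR : ∀ j : ℕ, (0 : ℝ) < j + 1 := fun j => by positivity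
  have hKc : ∀ j, μ.restrict (K j) (K j)ᶜ = 0 := fun j => by
    rw [Measure.restrict_apply (hKm j).compl]; simp
  choose M hM hF using fun j => exists_frostman_const hs0.le (hKreg j)
  have hacK : ∀ᵐ l ∂ω, ∀ j, (μ.restrict (K j)).map (P l) ≪ volume :=
    ae_all_iff.2 fun j => ae_map_absolutelyContinuous hac _ (hR j) (hM j)
      (measure_mono_null (compl_subset_compl.2 (hKball j)) (hKc j)) (hF j)
  -- Positive exponents strictly below `s - m` and converging to it, so that countably many lower
  -- bounds suffice.
  set t : ℕ → ℝ := fun i => (s - m) * ((i + 1 : ℕ) / ((i + 1 : ℕ) + 1)) with ht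
  have ht0 : ∀ i, 0 < t i := fun i => by simp only [ht]; positivity
  have hts : ∀ i, t i < s - m := fun i => by
    refine mul_lt_of_lt_one_right hd0 ((div_lt_one (by positivity)).2 (lt_add_one _))
  have htlim : Tendsto t atTop (𝓝 (s - m)) := by
    have h := ((tendsto_add_atTop_iff_nat 1).2
      (tendsto_natCast_div_add_atTop (1 : ℝ))).const_mul (s - m)
    simpa [ht] using h
  choose G hGm hGae hG using fun i j => exists_measurableSet_le_dimH_fiber (s := s) (C := C)
    hPm hPn hac
    (fun μ hμ hF => (hC μ hμ hF).le) (μ.restrict (K j)) (hKm j) (hKc j) (hR j) (hM j) (hKball j)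
    (hF j) (ENNReal.mul_ne_top (ENNReal.natCast_ne_top (j + 1)) (measure_ne_top μ univ))
    (exists_cover_of_subset_dyadicRegularSet (Nat.succ_ne_zero j) (hKreg j)) (ht0 i) (hts i)
  -- pairs `(x, l)` at which both bounds hold
  set H : Set (EuclideanSpace ℝ (Fin n) × Λ) := {p | (p.2, P p.2 p.1) ∉ N ∧
    ∀ i, ∃ j, p.1 ∈ K j ∧ (p.2, P p.2 p.1) ∈ G i j} with hH
  have hφ : Measurable fun p : EuclideanSpace ℝ (Fin n) × Λ => (p.2, P p.2 p.1) :=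
    measurable_snd.prodMk (hPm.comp measurable_swap)
  have hHm : MeasurableSet H := by
    have : H = (fun p : EuclideanSpace ℝ (Fin n) × Λ => (p.2, P p.2 p.1)) ⁻¹' Nᶜ ∩
        ⋂ i, ⋃ j, (Prod.fst ⁻¹' K j ∩
          (fun p : EuclideanSpace ℝ (Fin n) × Λ => (p.2, P p.2 p.1)) ⁻¹' G i j) := by
      ext p; simp [hH]
    rw [this]
    exact (hφ hNm.compl).inter (MeasurableSet.iInter fun i => MeasurableSet.iUnion fun j =>
      (measurable_fst (hKm j)).inter (hφ (hGm i j)))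
  have hHdim : ∀ p ∈ H, dimH (P p.2 ⁻¹' {P p.2 p.1} ∩ A) = ENNReal.ofReal (s - m) := by
    rintro ⟨x, l⟩ ⟨hpN, hpG⟩
    refine le_antisymm (hN l _ hpN) ?_
    refine le_of_tendsto (ENNReal.tendsto_ofReal htlim) (Eventually.of_forall fun i => ?_)
    obtain ⟨j, -, hj⟩ := hpG i
    exact (hG i j l _ hj).trans (dimH_mono (inter_subset_inter_right _ (hKA j)))
  have hHae : ∀ᵐ l ∂ω, ∀ᵐ x ∂μ, (x, l) ∈ H := by
    have hG' : ∀ᵐ l ∂ω, ∀ i j, ∀ᵐ u ∂(μ.restrict (K j)).map (P l), (l, u) ∈ G i j :=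
      ae_all_iff.2 fun i => ae_all_iff.2 fun j => hGae i j
    filter_upwards [hacK, hG'] with l hl hlG
    -- Absolute continuity turns the Lebesgue null section of `N` into a null set for the projection
    -- of each piece.
    have h1 : ∀ᵐ x ∂μ, ∀ j, x ∈ K j → (l, P l x) ∉ N := by
      refine ae_all_iff.2 fun j => (ae_restrict_iff' (hKm j)).1 ?_
      exact Measure.preimage_null_of_map_null (s := {u | (l, u) ∈ N}ᶜᶜ) (hPl l).aemeasurable
        (by rw [compl_compl]; exact hl j (hNnull l))
    have h2 : ∀ᵐ x ∂μ, ∀ i j, x ∈ K j → (l, P l x) ∈ G i j := by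
      refine ae_all_iff.2 fun i => ae_all_iff.2 fun j => (ae_restrict_iff' (hKm j)).1 ?_
      exact ae_of_ae_map (hPl l).aemeasurable (hlG i j)
    filter_upwards [hKae, h1, h2] with x ⟨j, hj⟩ hx1 hx2
    exact ⟨hx1 j hj, fun i => ⟨j, hj, hx2 i j hj⟩⟩
  constructor
  · have h : ∀ᵐ x ∂μ, ∀ᵐ l ∂ω, (x, l) ∈ H :=
      (Measure.ae_ae_comm (p := fun x l => (x, l) ∈ H) hHm).2 hHae
    have h' : ∀ᵐ p ∂μ.prod ω, p ∈ H := (Measure.ae_prod_mem_iff_ae_ae_mem hHm).2 h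
    filter_upwards [h'] with p hp using hHdim p hp
  · filter_upwards [hHae, hacK] with l hl hlac
    rw [pos_iff_ne_zero]
    intro h0
    -- If the good `u` formed a Lebesgue null set, absolute continuity would make their preimage
    -- null in every `K j`, although almost every `x` projects to a good `u`. Null preimages need no
    -- measurability of that set.
    have h1 : ∀ᵐ x ∂μ, ∀ j, x ∈ K j →
        ¬ dimH (P l ⁻¹' {P l x} ∩ A) = ENNReal.ofReal (s - m) := by
      refine ae_all_iff.2 fun j => (ae_restrict_iff' (hKm j)).1 ?_
      exact Measure.preimage_null_of_map_null
        (s := {u | dimH (P l ⁻¹' {u} ∩ A) = ENNReal.ofReal (s - m)}ᶜᶜ) (hPl l).aemeasurable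
        (by rw [compl_compl]; exact hlac j h0)
    have h2 : ∀ᵐ x ∂μ, False := by
      filter_upwards [hKae, hl, h1] with x ⟨j, hj⟩ hxH hx
      exact hx j hj (hHdim (x, l) hxH)
    have h3 : μ univ = 0 := by simpa [ae_iff] using h2
    rw [hμ, Measure.restrict_apply_univ] at h3
    exact hA_pos.ne' h3
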